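/- Let $F=\mathbb{R}$ or $F=\mathbb{C}$, let $n\ge 0$, $V=F^n$, and let $X=\mathfrak{sl}(V)\times V\times V^*$, regarded as an algebraic variety over $F$, where $\mathfrak{sl}(V)$ is the space of trace-zero operators on $V$. Equip $X$ with the scalar product $$\langle (A,v,\phi),(A',v',\phi')\rangle=\operatorname{tr}(AA')+\phi(v')+\phi'(v),$$ use it to identify $T^*X$ with $X\times X$ (the pair $(x_1,x_2)$ corresponds to the covector $\langle x_2,\cdot\rangle$ at $x_1$), and equip $X\times X$ with the standard symplectic form of $T^*X$ and its Poisson bracket. A (locally closed) subvariety $T\subset X\times X$ is called coisotropic if the ideal of regular functions that vanish on its closure $\overline{T}$ is closed under the Poisson bracket. Let $S\subset X$ be the set of all $(A,v,\phi)$ with $A^n=0$ and $\phi(A^iv)=0$ for $0\le i\le n$. Let $\check S\subset X\times X$ be the set of all $((A_1,v_1,\phi_1),(A_2,v_2,\phi_2))$ such that $$(A_i,v_j,\phi_j)\in S\ \text{ for all } i,j\in\{1,2\}\quad\text{and}\quad [A_1,A_2]+v_1\otimes\phi_2-v_2\otimes\phi_1=0,$$ and let $$\check C_{X\times X}=\{\phi_1=\phi_2=0\}\cup\{v_1=v_2=0\}\subset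 X\times X.$$ Then every coisotropic subvariety $T\subset X\times X$ with $T\subset\check S$ satisfies $T\subset\check C_{X\times X}$. -/

import Mathlib

open scoped Matrix

namespace GeoStat

/-- The linear space `X = sl(V) × V × V*`, `V = R ^ n`, with coordinates in a commutative ring `R`.
A functional `φ ∈ V*` is written as a row vector, so that `φ(v) = φ ⬝ᵥ v`. -/
abbrev XSpace (n : ℕ) (R : Type*) [CommRing R] : Type _ :=
  LieAlgebra.SpecialLinear.sl (Fin n) R × (Fin n → R) × (Fin n → R)

/-- The `sl(V)`-component of a point of `X`, as a matrix. -/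
def XSpace.A {n : ℕ} {R : Type*} [CommRing R] (x : XSpace n R) : Matrix (Fin n) (Fin n) R :=
  x.1

/-- The `V`-component of a point of `X`. -/
def XSpace.v {n : ℕ} {R : Type*} [CommRing R] (x : XSpace n R) : Fin n → R := x.2.1

/-- The `V*`-component of a point of `X`. -/
def XSpace.φ {n : ℕ} {R : Type*} [CommRing R] (x : XSpace n R) : Fin n → R := x.2.2

theorem mem_sl_iff {n : ℕ} {R : Type*} [CommRing R] (M : Matrix (Fin n) (Fin n) R) :
    M ∈ LieAlgebra.SpecialLinear.sl (Fin n) R ↔ M.trace = 0 := Iff.rfl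

theorem XSpace.trace_A {n : ℕ} {R : Type*} [CommRing R] (x : XSpace n R) : x.A.trace = 0 :=
  (mem_sl_iff _).1 x.1.2

/-- Change of the ring of coordinates along a ring homomorphism. -/
def XSpace.map {n : ℕ} {R R' : Type*} [CommRing R] [CommRing R'] (f : R →+* R')
    (x : XSpace n R) : XSpace n R' :=
  (⟨x.A.map f, (mem_sl_iff _).2 (by
    have h := congrArg f x.trace_A
    rw [map_zero, AddMonoidHom.map_trace f x.A] at h
    exact h)⟩, fun i => f (x.v i), fun i => f (x.φ i))

/-- The standard scalar product on `X`:
`⟨(A, v, φ), (A', v', φ')⟩ = tr (A A') + φ(v') + φ'(v)`. -/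
def scalarProduct (n : ℕ) (F : Type*) [CommRing F] : LinearMap.BilinForm F (XSpace n F) :=
  LinearMap.mk₂ F (fun x y => (x.A * y.A).trace + x.φ ⬝ᵥ y.v + y.φ ⬝ᵥ x.v)
    (fun x x' y => by
      simp [XSpace.A, XSpace.v, XSpace.φ, add_mul, add_dotProduct, dotProduct_add]; ring)
    (fun c x y => by
      simp [XSpace.A, XSpace.v, XSpace.φ]; ring)
    (fun x y y' => by
      simp [XSpace.A, XSpace.v, XSpace.φ, mul_add, add_dotProduct, dotProduct_add]; ring)
    (fun c x y => by
      simp [XSpace.A, XSpace.v, XSpace.φ]; ring)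

theorem scalarProduct_apply {n : ℕ} {F : Type*} [CommRing F] (x y : XSpace n F) :
    scalarProduct n F x y = (x.A * y.A).trace + x.φ ⬝ᵥ y.v + y.φ ⬝ᵥ x.v := rfl

theorem scalarProduct_nondegenerate (n : ℕ) (F : Type*) [Field F] [CharZero F] :
    (scalarProduct n F).Nondegenerate := by
  have symm : ∀ x y : XSpace n F, scalarProduct n F x y = scalarProduct n F y x := by
    intro x y
    rw [scalarProduct_apply, scalarProduct_apply, Matrix.trace_mul_comm]
    ring
  have sep : ∀ x : XSpace n F, (∀ y, scalarProduct n F x y = 0) → x = 0 := by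
    intro x hx
    have hA : x.A = 0 := by
      refine Matrix.ext_iff_trace_mul_right.2 fun M => ?_
      rcases Nat.eq_zero_or_pos n with h0 | hn
      · subst h0; simp [Matrix.trace]
      have hn' : (n : F) ≠ 0 := by exact_mod_cast hn.ne'
      have hM : (M - (M.trace / n) • (1 : Matrix (Fin n) (Fin n) F)).trace = 0 := by
        simp [Matrix.trace_sub, Matrix.trace_smul, hn']
      have h := hx (⟨_, (mem_sl_iff _).2 hM⟩, 0, 0)
      rw [scalarProduct_apply] at h
      simpa [XSpace.A, XSpace.v, XSpace.φ, mul_sub, Matrix.trace_sub, Matrix.trace_smul,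
        (mem_sl_iff _).1 x.1.2] using h
    have hv : x.v = 0 := by
      funext i
      have h := hx (0, 0, Pi.single i 1)
      rw [scalarProduct_apply] at h
      simpa [XSpace.A, XSpace.v, XSpace.φ] using h
    have hφ : x.φ = 0 := by
      funext i
      have h := hx (0, Pi.single i 1, 0)
      rw [scalarProduct_apply] at h
      simpa [XSpace.A, XSpace.v, XSpace.φ] using h
    exact Prod.ext (Subtype.ext hA) (Prod.ext hv hφ)
  exact ⟨sep, fun y hy => sep y fun x => (symm y x).trans (hy x)⟩

/-- `S`: the triples `(A, v, φ)` with `A` nilpotent and `φ(A ^ i v) = 0` for `0 ≤ i ≤ n`. -/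
def SSet (n : ℕ) (K : Type*) [Field K] : Set (XSpace n K) :=
  {x | x.A ^ n = 0 ∧ ∀ i ≤ n, x.φ ⬝ᵥ ((x.A ^ i) *ᵥ x.v) = 0}

/-- The `K`-points of `Š ⊆ X × X`: the pairs `((A₁, v₁, φ₁), (A₂, v₂, φ₂))` such that
`(Aᵢ, vⱼ, φⱼ) ∈ S` for all `i, j ∈ {1, 2}`, and `[A₁, A₂] + v₁ ⊗ φ₂ - v₂ ⊗ φ₁ = 0`. -/
def SCheck (n : ℕ) (K : Type*) [Field K] : Set (XSpace n K × XSpace n K) :=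
  {x | ((x.1.1, x.1.2) ∈ SSet n K ∧ (x.1.1, x.2.2) ∈ SSet n K ∧
        (x.2.1, x.1.2) ∈ SSet n K ∧ (x.2.1, x.2.2) ∈ SSet n K) ∧
      ⁅x.1.A, x.2.A⁆ + Matrix.vecMulVec x.1.v x.2.φ - Matrix.vecMulVec x.2.v x.1.φ = 0}

/-- The `K`-points of
`Č = (sl(V) × V × 0 × sl(V) × V × 0) ∪ (sl(V) × 0 × V* × sl(V) × 0 × V*) ⊆ X × X`. -/
def CCheck (n : ℕ) (K : Type*) [Field K] : Set (XSpace n K × XSpace n K) :=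
  {x | x.1.φ = 0 ∧ x.2.φ = 0} ∪ {x | x.1.v = 0 ∧ x.2.v = 0}

/-- The coordinate ring of `T*X`, for a basis `b` (indexed by `ι`) of the linear space `X`: the
variable `Sum.inl k` is the coordinate `q_k` dual to `b k`, and `Sum.inr k` is the conjugate
momentum `p_k`, the value of a covector at `b k`. -/
abbrev CoordRing (F ι : Type*) [Field F] : Type _ := MvPolynomial (ι ⊕ ι) F

/-- The Poisson bracket of the standard symplectic form on `T*X`,
`{f, g} = ∑ k, (∂f/∂p_k ∂g/∂q_k - ∂f/∂q_k ∂g/∂p_k)`. -/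
noncomputable def poissonBracket {F ι : Type*} [Field F] [Fintype ι] (f g : CoordRing F ι) :
    CoordRing F ι :=
  ∑ k : ι, (MvPolynomial.pderiv (Sum.inr k) f * MvPolynomial.pderiv (Sum.inl k) g -
    MvPolynomial.pderiv (Sum.inl k) f * MvPolynomial.pderiv (Sum.inr k) g)

/-- A subvariety `T` of `T*X` is coisotropic if the ideal of the regular functions vanishing on its
closure is closed under the Poisson bracket. (`T*X` is affine, so that ideals of global regular
functions are the same as quasi-coherent ideal sheaves.) -/
def IsCoisotropic {F ι : Type*} [Field F] [Fintype ι]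
    (T : Set (PrimeSpectrum (CoordRing F ι))) : Prop :=
  ∀ f ∈ PrimeSpectrum.vanishingIdeal (closure T),
    ∀ g ∈ PrimeSpectrum.vanishingIdeal (closure T),
      poissonBracket f g ∈ PrimeSpectrum.vanishingIdeal (closure T)

section

variable {n : ℕ} {F ι : Type*} [Field F] [CharZero F] [Fintype ι] [DecidableEq ι]

/-- The tautological point `(x₁, x₂)` of `X × X` with coordinates in the coordinate ring of `T*X`,
under the identification of `X × X` with `T*X` by the scalar product: the pair `(x₁, x₂)`
corresponds to the covector `⟨x₂, ·⟩` at `x₁`. So `x₁ = ∑ k, q_k b_k`, and `x₂ = ∑ k, p_k b'_k`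
with `b'` the dual basis, i.e. `⟨b'_k, b_l⟩ = δ_kl` (which says that `⟨x₂, b_k⟩ = p_k`). -/
noncomputable def tautologicalPoint (b : Module.Basis ι F (XSpace n F)) :
    XSpace n (CoordRing F ι) × XSpace n (CoordRing F ι) :=
  (∑ k, (MvPolynomial.X (Sum.inl k) : CoordRing F ι) • (b k).map MvPolynomial.C,
   ∑ k, (MvPolynomial.X (Sum.inr k) : CoordRing F ι) •
    (((scalarProduct n F).dualBasis (scalarProduct_nondegenerate n F) b) k).map MvPolynomial.C)

/-- The point of `X × X`, with coordinates in the residue field, given by a point `t` of the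
affine scheme `T*X = X × X`. -/
noncomputable def pointAt (b : Module.Basis ι F (XSpace n F))
    (t : PrimeSpectrum (CoordRing F ι)) :
    XSpace n t.asIdeal.ResidueField × XSpace n t.asIdeal.ResidueField :=
  ((tautologicalPoint b).1.map (algebraMap _ _), (tautologicalPoint b).2.map (algebraMap _ _))

/-- `Š` as a subset of the affine scheme `X × X`. -/
def SCheckLocus (b : Module.Basis ι F (XSpace n F)) : Set (PrimeSpectrum (CoordRing F ι)) :=
  {t | pointAt b t ∈ SCheck n t.asIdeal.ResidueField}

/-- `Č` as a subset of the affine scheme `X × X`. -/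
def CCheckLocus (b : Module.Basis ι F (XSpace n F)) : Set (PrimeSpectrum (CoordRing F ι)) :=
  {t | pointAt b t ∈ CCheck n t.asIdeal.ResidueField}

end

end GeoStat

/-! Let `I` be the vanishing ideal of the closure of `T`. By the Leibniz rule every minimal prime of
`I` is again closed under the bracket (`poissonBracket_mem_of_mem_minimalPrimes`). Since `T` is
locally closed, each of its points specializes from such a prime lying in `T`, and the target locus
is stable under specialization. So it suffices to treat one point, with residue field `K`, whose
prime is Poisson-closed: the bracket of two functions that vanish there vanishes there.

Write `A`, `B`, `x₁`, `x₂`, `ψ₁`, `ψ₂` for the values of `A₁`, `A₂`, `v₁`, `v₂`, `φ₁`, `φ₂`. First,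
`A` is regular nilpotent (`pow_pred_ne_zero_of_isNilpotent`): a Jordan block of size `k + 1 < n`
gives a vanishing function `f = w A₁ ^ (k + 1) u` with gradient `G` in `A₁`. Bracketing `f` with `tr
(A₂ ^ 2)` makes `tr (A₂ G)` vanish, and bracketing `f` with that contradicts the value of `tr (G ^
2) - (tr G) ^ 2 / n`.

Now `ker A` is a line, so the spaces `ker (A ^ i)` form a full flag. Take the least `i` such that
`ker (A ^ i)` contains `x₁` and `x₂`. If `i = 0`, both vectors vanish. Otherwise one of them
generates this kernel over `K[A]`, so `ψ₁` and `ψ₂` vanish on it; if `i = n`, both are zero. For `0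
< i < n`, nilpotency of `B` and the moment map equation give a bilinear relation between the leading
terms of the vectors and functionals (`pow_mul_vecMulVec_mul_pow_eq`). Differentiating it along the
Hamiltonian fields of the entries of `A₁ ^ i v₁` and `A₁ ^ i v₂` contradicts the minimality of `i`
(`pow_mulVec_eq_zero_of_bilinear_relation`). -/

/-! ### Nilpotent endomorphisms, in particular those whose kernel is a line -/

section LinearAlgebra

variable {K V : Type*} [Field K] [AddCommGroup V] [Module K V]

/-- If no Jordan block of a nilpotent `A` has size `k + 1`, for all `k < m`, then the kernel
of `A` is contained in the range of `A ^ m`. -/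
theorem Module.End.ker_le_range_pow (A : Module.End K V) (m : ℕ)
    (h : ∀ k < m, ∀ u, (A ^ (k + 1)) u = 0 → ∀ w : Module.Dual K V,
      (∀ x, w ((A ^ (k + 1)) x) = 0) → w ((A ^ k) u) = 0) :
    LinearMap.ker A ≤ LinearMap.range (A ^ m) := by
  induction m with
  | zero => intro x _; exact ⟨x, rfl⟩
  | succ m ih =>
    intro x hx
    obtain ⟨u, rfl⟩ := ih (fun k hk => h k (hk.trans m.lt_succ_self)) hx
    -- A functional that kills the range of `A ^ (m + 1)` but not `(A ^ m) u` would exhibit a Jordan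
    -- block of size `m + 1`.
    by_contra hu
    obtain ⟨w, hw, hle⟩ := Submodule.exists_le_ker_of_notMem hu
    refine hw (h m m.lt_succ_self u ?_ w fun y => hle ⟨y, rfl⟩)
    rw [pow_succ']
    exact hx

theorem Module.End.ker_ne_bot_of_isNilpotent [Nontrivial V] (A : Module.End K V)
    (hA : IsNilpotent A) : LinearMap.ker A ≠ ⊥ := by
  intro h
  obtain ⟨m, hm⟩ := hA
  have hinj : Function.Injective (A ^ m) := by
    rw [Module.End.coe_pow]
    exact (LinearMap.ker_eq_bot.1 h).iterate m
  obtain ⟨x, hx⟩ := exists_ne (0 : V)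
  exact hx (hinj (by rw [hm]; simp))

/-- Applying `A ^ (n - 1 - s - k)` kills the terms of index above `k`, induction removes those
below, and `c k • (A ^ (n - 1)) e` is left. -/
theorem Module.End.coeff_eq_zero_of_sum_pow_apply_eq_zero {n : ℕ} (A : Module.End K V)
    (hA : A ^ n = 0) {e : V} (he : (A ^ (n - 1)) e ≠ 0) (s : ℕ) (c : Fin n → K)
    (hc : ∑ k, c k • (A ^ ((k : ℕ) + s)) e = 0) (k : Fin n) (hk : k + s < n) : c k = 0 := by
  induction k using Fin.strong_induction_on with
  | _ k ih =>
  have h := congrArg (A ^ (n - 1 - s - k)) hc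
  rw [map_zero, map_sum, Finset.sum_eq_single k] at h
  · rw [map_smul, ← Module.End.mul_apply, ← pow_add,
      show n - 1 - s - (k : ℕ) + (k + s) = n - 1 by omega] at h
    exact (smul_eq_zero.1 h).resolve_right he
  · intro j _ hj
    rcases lt_or_gt_of_ne hj with hlt | hgt
    · rw [ih j hlt (by have : (j : ℕ) < k := hlt; omega), zero_smul, map_zero]
    · have hgt' : (k : ℕ) < j := hgt
      rw [map_smul, ← Module.End.mul_apply, ← pow_add, pow_eq_zero_of_le (by omega) hA]
      simp
  · simp

/-- A nilpotent endomorphism of maximal index has a one-dimensional kernel. -/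
theorem Module.End.exists_ker_le_span_singleton {n : ℕ} (hn : Module.finrank K V = n) (h0 : 0 < n)
    (A : Module.End K V) (hA : A ^ n = 0) (hA' : A ^ (n - 1) ≠ 0) :
    ∃ e : V, ∀ x, A x = 0 → ∃ c : K, x = c • e := by
  obtain ⟨e, he⟩ : ∃ e, (A ^ (n - 1)) e ≠ 0 := by
    by_contra! h
    exact hA' (LinearMap.ext h)
  have hli : LinearIndependent K fun k : Fin n => (A ^ (k : ℕ)) e := by
    rw [Fintype.linearIndependent_iff]
    exact fun c hc k => A.coeff_eq_zero_of_sum_pow_apply_eq_zero hA he 0 c hc k k.2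
  have : Nonempty (Fin n) := ⟨⟨0, h0⟩⟩
  have hspan := hli.span_eq_top_of_card_eq_finrank (by simp [hn])
  refine ⟨(A ^ (n - 1)) e, fun x hx => ?_⟩
  obtain ⟨c, rfl⟩ := (Submodule.mem_span_range_iff_exists_fun K).1
    (hspan ▸ Submodule.mem_top : x ∈ Submodule.span K (Set.range fun k : Fin n => (A ^ (k : ℕ)) e))
  -- The relation shifted by one kills every coefficient of `x` in the cyclic basis except the last.
  have hc : ∑ k, c k • (A ^ ((k : ℕ) + 1)) e = 0 := by
    rw [← hx, map_sum]
    exact Finset.sum_congr rfl fun k _ => by rw [map_smul, pow_succ', Module.End.mul_apply]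
  refine ⟨c ⟨n - 1, by omega⟩, ?_⟩
  rw [Finset.sum_eq_single ⟨n - 1, by omega⟩]
  · intro j _ hj
    have hj' : (j : ℕ) ≠ n - 1 := fun h => hj (Fin.ext h)
    rw [A.coeff_eq_zero_of_sum_pow_apply_eq_zero hA he 1 c hc j (by omega), zero_smul]
  · simp

/-- If the kernel of `A` is a line, then `ker (A ^ (i + 1))` is generated by any of its vectors that
does not lie in `ker (A ^ i)`. -/
theorem Module.End.dual_apply_eq_zero_of_pow_apply_eq_zero (A : Module.End K V) {e : V}
    (hker : ∀ x, A x = 0 → ∃ c : K, x = c • e) (f : Module.Dual K V) (i : ℕ) :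
    ∀ v x : V, (A ^ (i + 1)) v = 0 → (A ^ i) v ≠ 0 → (A ^ (i + 1)) x = 0 →
      (∀ k, f ((A ^ k) v) = 0) → f x = 0 := by
  induction i with
  | zero =>
    intro v x hv hv0 hx hf
    obtain ⟨c, hc⟩ := hker v (by simpa using hv)
    obtain ⟨d, rfl⟩ := hker x (by simpa using hx)
    have h := hf 0
    rw [pow_zero, Module.End.one_apply, hc, map_smul] at h
    rcases smul_eq_zero.1 h with h | h
    · simp [hc, h] at hv0
    · rw [map_smul, h, smul_zero]
  | succ i ih =>
    intro v x hv hv0 hx hf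
    obtain ⟨c, hc⟩ := hker ((A ^ (i + 1)) v) (by rw [← Module.End.mul_apply, ← pow_succ', hv])
    obtain ⟨d, hd⟩ := hker ((A ^ (i + 1)) x) (by rw [← Module.End.mul_apply, ← pow_succ', hx])
    have hc0 : c ≠ 0 := by rintro rfl; exact hv0 (by rw [hc, zero_smul])
    have hAv : ∀ k, (A ^ k) (A v) = (A ^ (k + 1)) v := fun k => by
      rw [pow_succ, Module.End.mul_apply]
    -- The multiple `d / c` cancels the leading term of `x`, so that the difference lies one step
    -- lower in the flag, where `A v` is a generator.
    have h := ih (A v) (x - (d / c) • v) (by rw [hAv, hv]) (by rwa [hAv])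
      (by rw [map_sub, map_smul, hc, hd, smul_smul, div_mul_cancel₀ _ hc0, sub_self])
      (fun k => by rw [hAv]; exact hf _)
    have hfv := hf 0
    rw [pow_zero, Module.End.one_apply] at hfv
    simpa [hfv] using h

/-- Since `A ^ j` embeds `ker (A ^ (j + 1)) / ker (A ^ j)` into the line `ker A`, the map induced by
`B` on this quotient is a scalar `c`, and nilpotency forces `c = 0`. -/
theorem Module.End.pow_apply_apply_eq_zero_of_isNilpotent (A B : Module.End K V) {e : V}
    (hker : ∀ x, A x = 0 → ∃ c : K, x = c • e) (hB : IsNilpotent B) (j : ℕ)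
    (h₁ : ∀ x, (A ^ j) x = 0 → (A ^ j) (B x) = 0)
    (h₂ : ∀ x, (A ^ (j + 1)) x = 0 → (A ^ (j + 1)) (B x) = 0) (x : V)
    (hx : (A ^ (j + 1)) x = 0) : (A ^ j) (B x) = 0 := by
  by_cases hx0 : (A ^ j) x = 0
  · exact h₁ x hx0
  obtain ⟨a, ha⟩ := hker ((A ^ j) x) (by rw [← Module.End.mul_apply, ← pow_succ', hx])
  obtain ⟨d, hd⟩ := hker ((A ^ j) (B x)) (by rw [← Module.End.mul_apply, ← pow_succ', h₂ x hx])
  have ha0 : a ≠ 0 := by rintro rfl; exact hx0 (by rw [ha, zero_smul])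
  set c := d / a
  have hc : (A ^ j) (B x) = c • (A ^ j) x := by
    rw [hd, ha, smul_smul, div_mul_cancel₀ _ ha0]
  have hpres : ∀ m y, (A ^ j) y = 0 → (A ^ j) ((B ^ m) y) = 0 := by
    intro m
    induction m with
    | zero => intro y hy; exact hy
    | succ m ih => intro y hy; rw [pow_succ, Module.End.mul_apply]; exact ih _ (h₁ y hy)
  have hpow : ∀ m, (A ^ j) ((B ^ m) x) = c ^ m • (A ^ j) x := by
    intro m
    induction m with
    | zero => simp
    | succ m ih =>
      have hy := hpres m (B x - c • x) (by rw [map_sub, map_smul, hc, sub_self])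
      rw [map_sub, map_sub, map_smul, map_smul, ih, sub_eq_zero] at hy
      rw [pow_succ, Module.End.mul_apply, hy, smul_smul, pow_succ']
  obtain ⟨m, hm⟩ := hB
  have h := hpow m
  rw [hm, LinearMap.zero_apply, map_zero] at h
  have hc0 : c = 0 := eq_zero_of_pow_eq_zero ((smul_eq_zero.1 h.symm).resolve_right hx0)
  rw [hc, hc0, zero_smul]

/-- If the kernel of `A` is a line and `B` is nilpotent, a commutator `[B, A]` which maps
`V / ker (A ^ (j + 1))` to `ker (A ^ (j + 1))` has no component from `ker (A ^ (j + 2))` to the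
quotient of `ker (A ^ (j + 1))` by `ker (A ^ j)`. -/
theorem Module.End.pow_apply_commutator_eq_zero (A B M : Module.End K V) {e : V}
    (hker : ∀ x, A x = 0 → ∃ c : K, x = c • e) (hB : IsNilpotent B) (hM : B * A - A * B = M) (j : ℕ)
    (h₁ : ∀ x, (A ^ (j + 1)) (M x) = 0) (h₂ : ∀ x, (A ^ (j + 1)) x = 0 → M x = 0) (x : V)
    (hx : (A ^ (j + 2)) x = 0) : (A ^ j) (M x) = 0 := by
  have hMx : ∀ x, M x = B (A x) - A (B x) := fun x => by rw [← hM]; rfl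
  have hAx : ∀ k x, (A ^ k) (A x) = (A ^ (k + 1)) x := fun k x => by
    rw [pow_succ, Module.End.mul_apply]
  -- As `M` vanishes on `ker (A ^ (j + 1))`, the maps `A` and `B` commute there, so `B` preserves
  -- the lower part of the flag.
  have hcomm : ∀ k x, (A ^ (j + 1)) x = 0 → (A ^ k) (B x) = B ((A ^ k) x) := by
    intro k
    induction k with
    | zero => intro x _; rfl
    | succ k ih =>
      intro x hx
      have h := h₂ x hx
      rw [hMx, sub_eq_zero] at h
      rw [← hAx, ← hAx, ← h]
      exact ih _ (by rw [hAx, pow_succ', Module.End.mul_apply, hx, map_zero])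
  have p₁ : ∀ x, (A ^ (j + 1)) x = 0 → (A ^ (j + 1)) (B x) = 0 := fun x hx => by
    rw [hcomm _ x hx, hx, map_zero]
  have p₀ : ∀ x, (A ^ j) x = 0 → (A ^ j) (B x) = 0 := fun x hx => by
    rw [hcomm _ x (by rw [pow_succ', Module.End.mul_apply, hx, map_zero]), hx, map_zero]
  have p₂ : ∀ x, (A ^ (j + 2)) x = 0 → (A ^ (j + 2)) (B x) = 0 := fun x hx => by
    have hx' : (A ^ (j + 1)) (A x) = 0 := by rw [hAx, hx]
    have h := h₁ x
    rw [hMx, map_sub, p₁ _ hx', zero_sub, neg_eq_zero, hAx] at h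
    exact h
  -- `B` strictly lowers the flag at `A x` and at `x`, so both terms of the commutator fall into
  -- `ker (A ^ j)`.
  rw [hMx, map_sub, hAx, A.pow_apply_apply_eq_zero_of_isNilpotent B hker hB j p₀ p₁ (A x)
    (by rw [hAx, hx]), A.pow_apply_apply_eq_zero_of_isNilpotent B hker hB (j + 1) p₁ p₂ x hx,
    sub_zero]

end LinearAlgebra

/-! ### Derivations with values in an algebra, applied to matrix expressions -/

section MatrixDerivation

variable {R K m : Type*} [CommRing R] [CommRing K] [Algebra R K] [Fintype m]
  (δ : Derivation ℤ R K)

theorem Derivation.map_dotProduct (w u : m → R) :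
    δ (w ⬝ᵥ u) = (δ ∘ w) ⬝ᵥ (algebraMap R K ∘ u) + (algebraMap R K ∘ w) ⬝ᵥ (δ ∘ u) := by
  simp only [dotProduct, map_sum, Derivation.leibniz, Algebra.smul_def, Function.comp_apply,
    ← Finset.sum_add_distrib]
  exact Finset.sum_congr rfl fun i _ => by ring

theorem Derivation.map_mulVec (M : Matrix m m R) (u : m → R) :
    δ ∘ (M *ᵥ u) = M.map δ *ᵥ (algebraMap R K ∘ u) + M.map (algebraMap R K) *ᵥ (δ ∘ u) :=
  funext fun i => δ.map_dotProduct (M i) u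

theorem Derivation.map_vecMul (w : m → R) (M : Matrix m m R) :
    δ ∘ (w ᵥ* M) = (δ ∘ w) ᵥ* M.map (algebraMap R K) + (algebraMap R K ∘ w) ᵥ* M.map δ :=
  funext fun i => δ.map_dotProduct w fun j => M j i

theorem Derivation.matrix_map_mul (M N : Matrix m m R) :
    (M * N).map δ = M.map δ * N.map (algebraMap R K) + M.map (algebraMap R K) * N.map δ :=
  Matrix.ext fun i j => δ.map_dotProduct (M i) fun k => N k j

theorem Derivation.map_trace (M : Matrix m m R) : δ M.trace = (M.map δ).trace := by
  simp [Matrix.trace]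

variable [DecidableEq m]

theorem Derivation.matrix_map_pow_succ (M : Matrix m m R) (k : ℕ) :
    (M ^ (k + 1)).map δ = ∑ a ∈ Finset.range (k + 1),
      M.map (algebraMap R K) ^ (k - a) * M.map δ * M.map (algebraMap R K) ^ a := by
  induction k with
  | zero => simp
  | succ k ih =>
    rw [pow_succ', δ.matrix_map_mul, ih, Finset.sum_range_succ _ (k + 1), Matrix.map_pow,
      Finset.mul_sum, add_comm]
    congr 1
    · refine Finset.sum_congr rfl fun a ha => ?_
      rw [Finset.mem_range] at ha
      rw [show k + 1 - a = (k - a) + 1 by omega, pow_succ']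
      simp only [mul_assoc]
    · simp

theorem Derivation.matrix_map_pow_eq_zero {M : Matrix m m R} (hM : M.map δ = 0) (k : ℕ) :
    (M ^ k).map δ = 0 := by
  cases k with
  | zero =>
    ext i j
    rw [pow_zero, Matrix.map_apply, Matrix.one_apply]
    split_ifs <;> simp
  | succ k => simp [δ.matrix_map_pow_succ, hM]

end MatrixDerivation

/-! ### The gradient of `w A ^ (k + 1) u` with respect to `A` -/

section PowSum

variable {S m : Type*} [CommRing S] [Fintype m] [DecidableEq m]

/-- The matrix `∑ a ≤ k, A ^ a u ⊗ w A ^ (k - a)`, the gradient of `w A ^ (k + 1) u` with respect to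
`A`. It commutes with `A` if `A ^ (k + 1) u = 0` and `w A ^ (k + 1) = 0`. -/
def Matrix.powGradient (A : Matrix m m S) (k : ℕ) (u w : m → S) : Matrix m m S :=
  ∑ a ∈ Finset.range (k + 1), Matrix.vecMulVec (A ^ a *ᵥ u) (w ᵥ* A ^ (k - a))

theorem Matrix.trace_mul_powGradient (A B : Matrix m m S) (k : ℕ) (u w : m → S) :
    (B * A.powGradient k u w).trace =
      ∑ a ∈ Finset.range (k + 1), w ⬝ᵥ ((A ^ (k - a) * B * A ^ a) *ᵥ u) := by
  rw [powGradient, Finset.mul_sum, Matrix.trace_sum]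
  refine Finset.sum_congr rfl fun a _ => ?_
  rw [Matrix.mul_vecMulVec, Matrix.trace_vecMulVec, dotProduct_comm, ← Matrix.dotProduct_mulVec,
    Matrix.mulVec_mulVec, Matrix.mulVec_mulVec, mul_assoc]

theorem Matrix.trace_powGradient (A : Matrix m m S) (k : ℕ) (u w : m → S) :
    (A.powGradient k u w).trace = (k + 1) * (w ⬝ᵥ (A ^ k *ᵥ u)) := by
  have h := A.trace_mul_powGradient 1 k u w
  rw [one_mul] at h
  rw [h, Finset.sum_congr rfl (g := fun _ => w ⬝ᵥ (A ^ k *ᵥ u))]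
  · simp
  · intro a ha
    rw [mul_one, ← pow_add, Nat.sub_add_cancel (Finset.mem_range_succ_iff.1 ha)]

/-- The trace is a double sum of products `(w A ^ (k - a + b) u) (w A ^ (k - b + a) u)`. Off the
diagonal one exponent exceeds `k` and the product vanishes; the `k + 1` diagonal terms are equal. -/
theorem Matrix.trace_powGradient_mul_self (A : Matrix m m S) (k : ℕ) (u w : m → S)
    (hu : A ^ (k + 1) *ᵥ u = 0) :
    (A.powGradient k u w * A.powGradient k u w).trace = (k + 1) * (w ⬝ᵥ (A ^ k *ᵥ u)) ^ 2 := by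
  have hu' : ∀ l, k < l → A ^ l *ᵥ u = 0 := fun l hl => by
    rw [← Nat.sub_add_cancel (Nat.succ_le_of_lt hl), pow_add, ← Matrix.mulVec_mulVec, hu,
      Matrix.mulVec_zero]
  rw [trace_mul_powGradient, Finset.sum_congr rfl (g := fun _ => (w ⬝ᵥ (A ^ k *ᵥ u)) ^ 2)]
  · simp
  intro a ha
  have hak := Finset.mem_range_succ_iff.1 ha
  rw [← Matrix.mulVec_mulVec, ← Matrix.mulVec_mulVec, powGradient, Matrix.sum_mulVec,
    Matrix.mulVec_sum, dotProduct_sum, Finset.sum_eq_single a]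
  · rw [Matrix.vecMulVec_mulVec, Matrix.mulVec_smul, Matrix.mulVec_mulVec, ← pow_add,
      Nat.sub_add_cancel hak, ← Matrix.dotProduct_mulVec, Matrix.mulVec_mulVec, ← pow_add,
      Nat.sub_add_cancel hak, sq]
    simp
  · intro b hb hba
    have hbk := Finset.mem_range_succ_iff.1 hb
    rw [Matrix.vecMulVec_mulVec, Matrix.mulVec_smul, Matrix.mulVec_mulVec, ← pow_add,
      ← Matrix.dotProduct_mulVec, Matrix.mulVec_mulVec, ← pow_add]
    rcases lt_or_gt_of_ne hba with h | h
    · rw [hu' (k - b + a) (by omega)]; simp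
    · rw [hu' (k - a + b) (by omega)]; simp
  · exact fun h => (h ha).elim

theorem Matrix.powGradient_smul (A : Matrix m m S) (k : ℕ) (u w : m → S) (c d : S) :
    A.powGradient k (c • u) (d • w) = (d * c) • A.powGradient k u w := by
  simp only [powGradient, Finset.smul_sum, Matrix.mulVec_smul, Matrix.smul_vecMul,
    Matrix.smul_vecMulVec, Matrix.vecMulVec_smul, smul_smul]

theorem Matrix.trace_single_sub_mul_powGradient (A : Matrix m m S) (k : ℕ) (u w : m → S) (i j : m)
    (c : S) :
    ((Matrix.single j i 1 - c • (1 : Matrix m m S)) * A.powGradient k u w).trace =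
      (A.powGradient k u w) i j - c * (A.powGradient k u w).trace := by
  rw [sub_mul, Matrix.trace_sub, Matrix.trace_single_mul, Matrix.smul_mul, Matrix.trace_smul,
    one_mul, one_smul, smul_eq_mul]

end PowSum

/-! ### Derivatives of `w A ^ (k + 1) u` and of the pairing with its gradient -/

section DerivationPowGradient

variable {R K m : Type*} [CommRing R] [CommRing K] [Algebra R K] [Fintype m] [DecidableEq m]
  (δ : Derivation ℤ R K)

theorem Derivation.map_dotProduct_pow_mulVec (A : Matrix m m R) (k : ℕ) (u w : m → R) :
    δ (w ⬝ᵥ (A ^ (k + 1) *ᵥ u)) =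
      (δ ∘ w) ⬝ᵥ (A.map (algebraMap R K) ^ (k + 1) *ᵥ (algebraMap R K ∘ u)) +
      (A.map δ * (A.map (algebraMap R K)).powGradient k (algebraMap R K ∘ u)
        (algebraMap R K ∘ w)).trace +
      ((algebraMap R K ∘ w) ᵥ* A.map (algebraMap R K) ^ (k + 1)) ⬝ᵥ (δ ∘ u) := by
  rw [δ.map_dotProduct, δ.map_mulVec, dotProduct_add, Matrix.trace_mul_powGradient,
    δ.matrix_map_pow_succ, Matrix.sum_mulVec, dotProduct_sum, ← Matrix.dotProduct_mulVec, add_assoc,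
    Matrix.map_pow]
  congr 2
  rw [← Matrix.map_pow]
  exact funext fun i => (RingHom.map_mulVec (algebraMap R K) (A ^ (k + 1)) u i)

theorem Derivation.map_trace_mul_powGradient {A : Matrix m m R} (hA : A.map δ = 0)
    (B : Matrix m m R) (k : ℕ) (u w : m → R) :
    δ (B * A.powGradient k u w).trace =
      (B.map δ * (A.map (algebraMap R K)).powGradient k (algebraMap R K ∘ u)
        (algebraMap R K ∘ w)).trace +
      (B.map (algebraMap R K) * (A.map (algebraMap R K)).powGradient k (δ ∘ u)
        (algebraMap R K ∘ w)).trace +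
      (B.map (algebraMap R K) * (A.map (algebraMap R K)).powGradient k (algebraMap R K ∘ u)
        (δ ∘ w)).trace := by
  simp only [Matrix.trace_mul_powGradient, map_sum, ← Finset.sum_add_distrib]
  refine Finset.sum_congr rfl fun a _ => ?_
  rw [δ.map_dotProduct, δ.map_mulVec, δ.matrix_map_mul, δ.matrix_map_mul,
    δ.matrix_map_pow_eq_zero hA, δ.matrix_map_pow_eq_zero hA, dotProduct_add]
  simp only [Matrix.map_pow, Matrix.map_mul, zero_mul, zero_add, mul_zero, add_zero]
  rw [← Matrix.map_pow, ← Matrix.map_pow, ← Matrix.map_mul, ← Matrix.map_mul]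
  have : algebraMap R K ∘ ((A ^ (k - a) * B * A ^ a) *ᵥ u) =
      (A ^ (k - a) * B * A ^ a).map (algebraMap R K) *ᵥ (algebraMap R K ∘ u) :=
    funext fun i => RingHom.map_mulVec (algebraMap R K) _ u i
  rw [this]
  ring

end DerivationPowGradient

/-! ### Regularity of the nilpotent matrix `A₁` at a Poisson-closed point -/

section Core

variable {R K : Type*} [CommRing R] [Field K] [Algebra R K] {n : ℕ}

/-- The Hamiltonian vector field of `f`, at a point with values in `K`. -/
noncomputable def hamiltonianAt (K : Type*) [Field K] [Algebra R K] (br : R → Derivation ℤ R R)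
    (f : R) : Derivation ℤ R K :=
  (Algebra.linearMap R K).compDer (br f)

variable {br : R → Derivation ℤ R R}

theorem hamiltonianAt_apply (f g : R) : hamiltonianAt K br f g = algebraMap R K (br f g) := rfl

theorem hamiltonianAt_anti (anti : ∀ f g, br f g = -br g f) (f g : R) :
    hamiltonianAt K br f g = -hamiltonianAt K br g f := by
  rw [hamiltonianAt_apply, hamiltonianAt_apply, anti f g, map_neg]

/-- The coefficients `u` and `w` are functions, not constants; `hu` and `hw` make their derivatives
drop out, so only the gradient contributes. The multiple of the identity is the correction for trace
zero. -/
theorem hamiltonianAt_powGradient (anti : ∀ f g, br f g = -br g f)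
    {A₁ A₂ : Matrix (Fin n) (Fin n) R} {c : R}
    (h₂₁ : ∀ i j, A₁.map (br (A₂ i j)) = Matrix.single j i 1 - (if i = j then c else 0) • 1)
    {k : ℕ} {u w : Fin n → R}
    (hu : A₁.map (algebraMap R K) ^ (k + 1) *ᵥ (algebraMap R K ∘ u) = 0)
    (hw : (algebraMap R K ∘ w) ᵥ* A₁.map (algebraMap R K) ^ (k + 1) = 0) :
    A₂.map (hamiltonianAt K br (w ⬝ᵥ (A₁ ^ (k + 1) *ᵥ u))) =
      (algebraMap R K c * ((A₁.map (algebraMap R K)).powGradient k (algebraMap R K ∘ u)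
        (algebraMap R K ∘ w)).trace) • (1 : Matrix (Fin n) (Fin n) K) -
      (A₁.map (algebraMap R K)).powGradient k (algebraMap R K ∘ u) (algebraMap R K ∘ w) := by
  ext i j
  have h : A₁.map (hamiltonianAt K br (A₂ i j)) = Matrix.single j i 1 -
      (if i = j then algebraMap R K c else 0) • (1 : Matrix (Fin n) (Fin n) K) := by
    have h := congrArg (fun M => M.map (algebraMap R K)) (h₂₁ i j)
    rw [show A₁.map (hamiltonianAt K br (A₂ i j)) =
      (A₁.map (br (A₂ i j))).map (algebraMap R K) from rfl]
    simp only [h₂₁]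
    ext p q
    simp only [Matrix.map_apply, Matrix.sub_apply, Matrix.smul_apply, Matrix.single_apply,
      Matrix.one_apply, map_sub, smul_eq_mul, map_mul, apply_ite (algebraMap R K), map_one, map_zero]
  rw [Matrix.map_apply, hamiltonianAt_anti anti, Derivation.map_dotProduct_pow_mulVec, hu, hw,
    dotProduct_zero, zero_dotProduct, zero_add, add_zero, h,
    Matrix.trace_single_sub_mul_powGradient, neg_sub, Matrix.sub_apply, Matrix.smul_apply,
    Matrix.one_apply]
  split_ifs <;> simp

theorem hamiltonianAt_map_eq_zero (anti : ∀ f g, br f g = -br g f)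
    {A : Matrix (Fin n) (Fin n) R} (h : ∀ i j, A.map (br (A i j)) = 0)
    {k : ℕ} {u w : Fin n → R}
    (hu : A.map (algebraMap R K) ^ (k + 1) *ᵥ (algebraMap R K ∘ u) = 0)
    (hw : (algebraMap R K ∘ w) ᵥ* A.map (algebraMap R K) ^ (k + 1) = 0) :
    A.map (hamiltonianAt K br (w ⬝ᵥ (A ^ (k + 1) *ᵥ u))) = 0 := by
  ext i j
  have h' : A.map (hamiltonianAt K br (A i j)) = 0 := by
    rw [show A.map (hamiltonianAt K br (A i j)) =
      (A.map (br (A i j))).map (algebraMap R K) from rfl, h]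
    exact Matrix.map_zero _ (map_zero _)
  rw [Matrix.map_apply, hamiltonianAt_anti anti, Derivation.map_dotProduct_pow_mulVec, hu, hw, h']
  simp

theorem algebraMap_dotProduct_mulVec (w u : Fin n → R) (M : Matrix (Fin n) (Fin n) R) :
    algebraMap R K (w ⬝ᵥ (M *ᵥ u)) =
      (algebraMap R K ∘ w) ⬝ᵥ (M.map (algebraMap R K) *ᵥ (algebraMap R K ∘ u)) := by
  rw [RingHom.map_dotProduct]
  congr 1
  exact funext fun i => RingHom.map_mulVec (algebraMap R K) M u i

/-- The function attached to a Jordan block of size `k + 1` is bracketed twice, starting from the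
vanishing of `tr (A₂ ^ 2)`. With `t = w A ^ k u`, the second bracket gives `(k + 1) t ^ 2 (k + 1 -
n) = 0`. -/
theorem pow_pred_ne_zero_of_isNilpotent [CharZero K] (hn : 0 < n)
    (anti : ∀ f g, br f g = -br g f)
    (hbr : ∀ f g, algebraMap R K f = 0 → algebraMap R K g = 0 → algebraMap R K (br f g) = 0)
    (hlift : ∀ u : Fin n → K, ∃ c : K, c ≠ 0 ∧ ∃ u' : Fin n → R, algebraMap R K ∘ u' = c • u)
    {A₁ A₂ : Matrix (Fin n) (Fin n) R} {c : R} (hc : (n : R) * c = 1)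
    (h₁₁ : ∀ i j, A₁.map (br (A₁ i j)) = 0)
    (h₂₁ : ∀ i j, A₁.map (br (A₂ i j)) = Matrix.single j i 1 - (if i = j then c else 0) • 1)
    (htr : A₂.trace = 0) (hA₁ : A₁.map (algebraMap R K) ^ n = 0)
    (hA₂ : IsNilpotent (A₂.map (algebraMap R K))) :
    A₁.map (algebraMap R K) ^ (n - 1) ≠ 0 := by
  set A := A₁.map (algebraMap R K) with hAdef
  set B := A₂.map (algebraMap R K) with hBdef
  have hBtr : B.trace = 0 := by
    rw [hBdef, ← AddMonoidHom.map_trace (algebraMap R K) A₂, htr, map_zero]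
  intro hA
  -- the first order consequences of `tr (A₂ ^ 2) = 0`
  have hlin' : ∀ (k : ℕ) (u w : Fin n → R), A ^ (k + 1) *ᵥ (algebraMap R K ∘ u) = 0 →
      (algebraMap R K ∘ w) ᵥ* A ^ (k + 1) = 0 →
      (B * A.powGradient k (algebraMap R K ∘ u) (algebraMap R K ∘ w)).trace = 0 := by
    intro k u w hu hw
    have hf : algebraMap R K (w ⬝ᵥ (A₁ ^ (k + 1) *ᵥ u)) = 0 := by
      rw [algebraMap_dotProduct_mulVec, Matrix.map_pow, hu, dotProduct_zero]
    have hg : algebraMap R K (A₂ * A₂).trace = 0 := by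
      rw [AddMonoidHom.map_trace (algebraMap R K), Matrix.map_mul]
      exact (Matrix.isNilpotent_trace_of_isNilpotent
        ((Commute.refl B).isNilpotent_mul_left hA₂)).eq_zero
    have h : hamiltonianAt K br (w ⬝ᵥ (A₁ ^ (k + 1) *ᵥ u)) (A₂ * A₂).trace = 0 := hbr _ _ hf hg
    rw [Derivation.map_trace, Derivation.matrix_map_mul, hamiltonianAt_powGradient anti h₂₁ hu hw,
      Matrix.trace_add, Matrix.trace_mul_comm, ← two_mul, mul_sub, Matrix.trace_sub,
      Matrix.mul_smul, mul_one, Matrix.trace_smul, hBtr, smul_zero, zero_sub] at h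
    simpa using h
  -- Clearing denominators extends this to vectors over `K`; it will be applied to derivatives of
  -- `u'` and `w'`, which are only `K`-valued.
  have hlin : ∀ (k : ℕ) (u w : Fin n → K), A ^ (k + 1) *ᵥ u = 0 → w ᵥ* A ^ (k + 1) = 0 →
      (B * A.powGradient k u w).trace = 0 := by
    intro k u w hu hw
    obtain ⟨a, ha, u', hu'⟩ := hlift u
    obtain ⟨d, hd, w', hw'⟩ := hlift w
    have h := hlin' k u' w' (by rw [hu', Matrix.mulVec_smul, hu, smul_zero])
      (by rw [hw', Matrix.smul_vecMul, hw, smul_zero])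
    rw [hu', hw', Matrix.powGradient_smul, Matrix.mul_smul, Matrix.trace_smul] at h
    exact (smul_eq_zero.1 h).resolve_left (mul_ne_zero hd ha)
  -- a nonregular nilpotent `A` has a Jordan block of size `k + 1 < n`
  obtain ⟨k, hk, u, hu, w, hw, huw⟩ : ∃ k < n - 1, ∃ u, A ^ (k + 1) *ᵥ u = 0 ∧ ∃ w,
      w ᵥ* A ^ (k + 1) = 0 ∧ w ⬝ᵥ (A ^ k *ᵥ u) ≠ 0 := by
    by_contra! hcon
    have : Nonempty (Fin n) := ⟨⟨0, hn⟩⟩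
    -- Without such a block, `ker A` would lie in the range of `A ^ (n - 1) = 0`.
    have hle := Module.End.ker_le_range_pow (Matrix.toLin' A) (n - 1) (by
      intro k hk u hu w hw
      rw [← Matrix.toLin'_pow, Matrix.toLin'_apply] at hu ⊢
      have hwdot : ∀ x : Fin n → K, w x = (fun i => w (Pi.single i 1)) ⬝ᵥ x := by
        intro x
        conv_lhs => rw [pi_eq_sum_univ' x]
        simp [dotProduct, mul_comm]
      rw [hwdot]
      refine hcon k hk u hu _ (funext fun j => ?_)
      have h := hw (Pi.single j 1)
      rw [← Matrix.toLin'_pow, Matrix.toLin'_apply, hwdot, Matrix.dotProduct_mulVec] at h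
      simpa using h)
    rw [← Matrix.toLin'_pow, hA, map_zero, LinearMap.range_zero, le_bot_iff] at hle
    refine Module.End.ker_ne_bot_of_isNilpotent (Matrix.toLin' A) ⟨n, ?_⟩ hle
    rw [← Matrix.toLin'_pow, hA₁, map_zero]
  obtain ⟨a, ha, u', hu'⟩ := hlift u
  obtain ⟨d, hd, w', hw'⟩ := hlift w
  replace huw : (algebraMap R K ∘ w') ⬝ᵥ (A ^ k *ᵥ (algebraMap R K ∘ u')) ≠ 0 := by
    rw [hu', hw', Matrix.mulVec_smul, smul_dotProduct, dotProduct_smul]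
    exact smul_ne_zero hd (smul_ne_zero ha huw)
  replace hu : A ^ (k + 1) *ᵥ (algebraMap R K ∘ u') = 0 := by
    rw [hu', Matrix.mulVec_smul, hu, smul_zero]
  replace hw : (algebraMap R K ∘ w') ᵥ* A ^ (k + 1) = 0 := by
    rw [hw', Matrix.smul_vecMul, hw, smul_zero]
  have hf : algebraMap R K (w' ⬝ᵥ (A₁ ^ (k + 1) *ᵥ u')) = 0 := by
    rw [algebraMap_dotProduct_mulVec, Matrix.map_pow, hu, dotProduct_zero]
  set δ := hamiltonianAt K br (w' ⬝ᵥ (A₁ ^ (k + 1) *ᵥ u')) with hδ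
  have hδ0 : ∀ g, algebraMap R K g = 0 → δ g = 0 := fun g hg => hbr _ _ hf hg
  have hδA : A₁.map δ = 0 := hamiltonianAt_map_eq_zero anti h₁₁ hu hw
  -- Since `δ` kills `A₁`, differentiating the vanishing entries of `A₁ ^ (k + 1) u'` keeps `δ ∘ u'`
  -- in the same kernel. Hence `hlin` removes the terms with derivatives of `u'`, and likewise of
  -- `w'`.
  have hδu : A ^ (k + 1) *ᵥ (δ ∘ u') = 0 := by
    have h := δ.map_mulVec (A₁ ^ (k + 1)) u'
    rw [δ.matrix_map_pow_eq_zero hδA, Matrix.zero_mulVec, zero_add, Matrix.map_pow] at h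
    rw [← h]
    refine funext fun i => hδ0 _ ?_
    rw [RingHom.map_mulVec, Matrix.map_pow, hu, Pi.zero_apply]
  have hδw : (δ ∘ w') ᵥ* A ^ (k + 1) = 0 := by
    have h := δ.map_vecMul w' (A₁ ^ (k + 1))
    rw [δ.matrix_map_pow_eq_zero hδA, Matrix.vecMul_zero, add_zero, Matrix.map_pow] at h
    rw [← h]
    refine funext fun i => hδ0 _ ?_
    rw [RingHom.map_vecMul, Matrix.map_pow, hw, Pi.zero_apply]
  have hg : algebraMap R K (A₂ * A₁.powGradient k u' w').trace = 0 := by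
    rw [← hlin' k u' w' hu hw, Matrix.trace_mul_powGradient, Matrix.trace_mul_powGradient, map_sum]
    refine Finset.sum_congr rfl fun i _ => ?_
    rw [algebraMap_dotProduct_mulVec, Matrix.map_mul, Matrix.map_mul, Matrix.map_pow,
      Matrix.map_pow]
  have h := hδ0 _ hg
  rw [δ.map_trace_mul_powGradient hδA, hlin k _ _ hδu hw, hlin k _ _ hu hδw, add_zero, add_zero, hδ,
    hamiltonianAt_powGradient anti h₂₁ hu hw, sub_mul, Matrix.trace_sub, Matrix.smul_mul, one_mul,
    Matrix.trace_smul, Matrix.trace_powGradient_mul_self _ _ _ _ hu, Matrix.trace_powGradient] at h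
  have hc' : (n : K) * algebraMap R K c = 1 := by
    rw [← map_natCast (algebraMap R K), ← map_mul, hc, map_one]
  set t := (algebraMap R K ∘ w') ⬝ᵥ (A ^ k *ᵥ (algebraMap R K ∘ u'))
  have h' : ((k : K) + 1) * t ^ 2 * ((k + 1) - n) = 0 := by
    rw [smul_eq_mul] at h
    linear_combination (n : K) * h - ((k : K) + 1) ^ 2 * t ^ 2 * hc'
  refine mul_ne_zero (mul_ne_zero (Nat.cast_add_one_ne_zero k) (pow_ne_zero 2 huw)) ?_ h'
  rw [sub_ne_zero]
  exact_mod_cast (by omega : k + 1 ≠ n)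

end Core

/-! ### Vectors and functionals over a regular nilpotent matrix -/

section Core

variable {R K : Type*} [CommRing R] [Field K] [Algebra R K] {n : ℕ} {br : R → Derivation ℤ R R}

/-- By antisymmetry it is enough to differentiate `A ^ k v` along the field of `x`, which does not
move `A`. -/
theorem hamiltonianAt_pow_mulVec (anti : ∀ f g, br f g = -br g f)
    {A : Matrix (Fin n) (Fin n) R} {x : R} (hx : ∀ i j, br x (A i j) = 0) (v : Fin n → R) (k : ℕ)
    (l : Fin n) :
    hamiltonianAt K br ((A ^ k *ᵥ v) l) x =
      -(A.map (algebraMap R K) ^ k *ᵥ (hamiltonianAt K br x ∘ v)) l := by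
  have hA : A.map (hamiltonianAt K br x) = 0 := by
    ext i j
    simp [hamiltonianAt_apply, hx]
  have h := congrFun ((hamiltonianAt K br x).map_mulVec (A ^ k) v) l
  rw [Derivation.matrix_map_pow_eq_zero _ hA, Matrix.zero_mulVec, zero_add, Matrix.map_pow] at h
  rw [hamiltonianAt_anti anti, ← h]
  rfl

/-- If the functions `A ^ k v` vanish on a coisotropic subvariety, where `φ` is conjugate to `v`,
then the relations which are bilinear in `A ^ j v` and `φ A ^ r` can be differentiated in the
direction of `φ`. -/
theorem pow_mulVec_eq_zero_of_bilinear_relation (anti : ∀ f g, br f g = -br g f)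
    (hbr : ∀ f g, algebraMap R K f = 0 → algebraMap R K g = 0 → algebraMap R K (br f g) = 0)
    {A : Matrix (Fin n) (Fin n) R} {v v' φ φ' : Fin n → R} {s : R} (hs : algebraMap R K s ≠ 0)
    (hAA : ∀ i j p q, br (A i j) (A p q) = 0) (hAv : ∀ i j p, br (A i j) (v p) = 0)
    (hvA : ∀ p i j, br (v p) (A i j) = 0) (hvv : ∀ p q, br (v p) (v q) = 0)
    (hvA' : ∀ p i j, br (v' p) (A i j) = 0) (hvv' : ∀ p q, br (v' p) (v q) = 0)
    (hφA : ∀ p i j, br (φ p) (A i j) = 0)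
    (hφv : ∀ p q, br (φ p) (v q) = if p = q then s else 0)
    (hφA' : ∀ p i j, br (φ' p) (A i j) = 0) (hφv' : ∀ p q, br (φ' p) (v q) = 0)
    {k j r : ℕ} (hk : A.map (algebraMap R K) ^ k *ᵥ (algebraMap R K ∘ v) = 0)
    (hrel : ∀ p q, algebraMap R K ((A ^ j *ᵥ v) p * (φ ᵥ* A ^ r) q -
      (A ^ j *ᵥ v') p * (φ' ᵥ* A ^ r) q) = 0)
    (hreg : A.map (algebraMap R K) ^ (k + r) ≠ 0) :
    A.map (algebraMap R K) ^ j *ᵥ (algebraMap R K ∘ v) = 0 := by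
  obtain ⟨l, q, hlq⟩ : ∃ l q, (A.map (algebraMap R K) ^ (k + r)) l q ≠ 0 := by
    by_contra! h
    exact hreg (Matrix.ext h)
  have hmap : ∀ (m : ℕ) (x : Fin n → R) (p : Fin n), algebraMap R K ((A ^ m *ᵥ x) p) =
      (A.map (algebraMap R K) ^ m *ᵥ (algebraMap R K ∘ x)) p := fun m x p => by
    rw [RingHom.map_mulVec, Matrix.map_pow]
  set δ := hamiltonianAt K br ((A ^ k *ᵥ v) l) with hδ
  have hδ0 : ∀ g, algebraMap R K g = 0 → δ g = 0 := fun g hg =>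
    hbr _ _ (by rw [hmap, hk, Pi.zero_apply]) hg
  have hδx : ∀ x, (∀ i j, br x (A i j) = 0) → (∀ p, br x (v p) = 0) → δ x = 0 := by
    intro x hA hv
    rw [hδ, hamiltonianAt_pow_mulVec anti hA,
      show hamiltonianAt K br x ∘ v = 0 from funext fun p => by simp [hamiltonianAt_apply, hv]]
    simp
  have hδA : A.map δ = 0 := Matrix.ext fun i j => hδx _ (hAA i j) (hAv i j)
  have hδv : δ ∘ v = 0 := funext fun p => hδx _ (hvA p) (hvv p)
  have hδv' : δ ∘ v' = 0 := funext fun p => hδx _ (hvA' p) (hvv' p)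
  have hδφ' : δ ∘ φ' = 0 := funext fun p => hδx _ (hφA' p) (hφv' p)
  -- Of the variables in the relation only `φ` moves, by a multiple of row `l` of `A ^ k`.
  -- Multiplied by `A ^ r` this row has the nonzero entry `(l, q)` of `A ^ (k + r)`, so the factor
  -- `A ^ j v` must vanish.
  have hδφ : δ ∘ φ = -algebraMap R K s • (A.map (algebraMap R K) ^ k) l := by
    funext p
    rw [Function.comp_apply, hδ, hamiltonianAt_pow_mulVec anti (hφA p),
      show hamiltonianAt K br (φ p) ∘ v = Pi.single p (algebraMap R K s) from funext fun q => by
        simp [hamiltonianAt_apply, hφv, Pi.single_apply, apply_ite (algebraMap R K), eq_comm]]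
    simp [mul_comm]
  have hpv : ∀ (m : ℕ) (x : Fin n → R), δ ∘ x = 0 → ∀ p, δ ((A ^ m *ᵥ x) p) = 0 := by
    intro m x hx p
    have h := congrFun (δ.map_mulVec (A ^ m) x) p
    rw [δ.matrix_map_pow_eq_zero hδA, hx] at h
    simpa using h
  have hφr : ∀ (x : Fin n → R) q, δ ((x ᵥ* A ^ r) q) =
      ((δ ∘ x) ᵥ* A.map (algebraMap R K) ^ r) q := by
    intro x q
    have h := congrFun (δ.map_vecMul x (A ^ r)) q
    rw [δ.matrix_map_pow_eq_zero hδA, Matrix.map_pow] at h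
    simpa using h
  funext p
  have h := hδ0 _ (hrel p q)
  rw [map_sub, Derivation.leibniz, Derivation.leibniz, hpv j v hδv, hpv j v' hδv', hφr, hφr, hδφ',
    hδφ, Matrix.zero_vecMul, Pi.zero_apply, smul_zero, smul_zero, smul_zero, add_zero, add_zero,
    sub_zero, Matrix.smul_vecMul, Pi.smul_apply, Algebra.smul_def, hmap,
    show ((A.map (algebraMap R K) ^ k) l ᵥ* A.map (algebraMap R K) ^ r) q =
      (A.map (algebraMap R K) ^ (k + r)) l q by rw [pow_add]; rfl] at h
  simpa [hs, hlq] using h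

/-- For a regular nilpotent `A` and a nilpotent `B`, whose commutator is given by vectors in
`ker (A ^ (j + 1))` and functionals which vanish there. -/
theorem pow_mul_vecMulVec_mul_pow_eq {A B : Matrix (Fin n) (Fin n) K} (hA : A ^ n = 0)
    (hA' : A ^ (n - 1) ≠ 0) (hB : IsNilpotent B) {v₁ v₂ φ₁ φ₂ : Fin n → K}
    (hM : ⁅A, B⁆ + Matrix.vecMulVec v₁ φ₂ - Matrix.vecMulVec v₂ φ₁ = 0) {j : ℕ} (hj : j + 2 ≤ n)
    (hv₁ : A ^ (j + 1) *ᵥ v₁ = 0) (hv₂ : A ^ (j + 1) *ᵥ v₂ = 0)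
    (hφ₁ : ∀ x, A ^ (j + 1) *ᵥ x = 0 → φ₁ ⬝ᵥ x = 0)
    (hφ₂ : ∀ x, A ^ (j + 1) *ᵥ x = 0 → φ₂ ⬝ᵥ x = 0) (p q : Fin n) :
    (A ^ j *ᵥ v₁) p * (φ₂ ᵥ* A ^ (n - (j + 2))) q -
      (A ^ j *ᵥ v₂) p * (φ₁ ᵥ* A ^ (n - (j + 2))) q = 0 := by
  set M := Matrix.vecMulVec v₁ φ₂ - Matrix.vecMulVec v₂ φ₁ with hMdef
  have hMx : ∀ x, M *ᵥ x = (φ₂ ⬝ᵥ x) • v₁ - (φ₁ ⬝ᵥ x) • v₂ := fun x => by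
    simp [hMdef, Matrix.sub_mulVec, Matrix.vecMulVec_mulVec]
  have hcomm : Matrix.toLin' B * Matrix.toLin' A - Matrix.toLin' A * Matrix.toLin' B =
      Matrix.toLin' M := by
    rw [Module.End.mul_eq_comp, Module.End.mul_eq_comp, ← Matrix.toLin'_mul, ← Matrix.toLin'_mul,
      ← map_sub]
    congr 1
    rw [add_sub_assoc, Ring.lie_def, ← hMdef] at hM
    rw [← sub_eq_zero, ← neg_eq_zero, ← hM]
    abel
  obtain ⟨e, he⟩ := Module.End.exists_ker_le_span_singleton (K := K) (V := Fin n → K) (n := n)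
    (by simp) (by omega) (Matrix.toLin' A) (by rw [← Matrix.toLin'_pow, hA, map_zero])
    (by rwa [← Matrix.toLin'_pow, Ne, LinearEquiv.map_eq_zero_iff])
  obtain ⟨m, hm⟩ := hB
  have h := Module.End.pow_apply_commutator_eq_zero (Matrix.toLin' A) (Matrix.toLin' B)
    (Matrix.toLin' M) he ⟨m, by rw [← Matrix.toLin'_pow, hm, map_zero]⟩ hcomm j
    (fun x => by
      rw [← Matrix.toLin'_pow, Matrix.toLin'_apply, Matrix.toLin'_apply, hMx, Matrix.mulVec_sub,
        Matrix.mulVec_smul, Matrix.mulVec_smul, hv₁, hv₂]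
      simp)
    (fun x hx => by
      rw [← Matrix.toLin'_pow, Matrix.toLin'_apply] at hx
      rw [Matrix.toLin'_apply, hMx, hφ₁ x hx, hφ₂ x hx]
      simp)
    -- As `A ^ n = 0`, this test vector lies in `ker (A ^ (j + 2))`.
    (A ^ (n - (j + 2)) *ᵥ Pi.single q 1)
    (by rw [← Matrix.toLin'_pow, Matrix.toLin'_apply, Matrix.mulVec_mulVec, ← pow_add,
          Nat.add_sub_cancel' hj, hA, Matrix.zero_mulVec])
  rw [← Matrix.toLin'_pow, Matrix.toLin'_apply, Matrix.toLin'_apply, hMx, Matrix.mulVec_sub,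
    Matrix.mulVec_smul, Matrix.mulVec_smul, Matrix.dotProduct_mulVec, Matrix.dotProduct_mulVec,
    dotProduct_single_one, dotProduct_single_one] at h
  simpa [mul_comm] using congrFun h p

/-- Linear coordinates on `T*X = X × X`, `X = sl(V) × V × V*`, which satisfy the canonical
commutation relations for the bracket `br`, up to those which do not involve the first copy of
`sl(V)`. -/
structure CanonicalCoordinates (br : R → Derivation ℤ R R) (A₁ A₂ : Matrix (Fin n) (Fin n) R)
    (v₁ v₂ φ₁ φ₂ : Fin n → R) : Prop where
  anti : ∀ f g, br f g = -br g f
  trace_A₂ : A₂.trace = 0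
  A₁_A₁ : ∀ i j p q, br (A₁ i j) (A₁ p q) = 0
  -- Here `c` is `1 / n`: the matrix unit has to be projected to trace zero.
  A₂_A₁ : ∃ c : R, (0 < n → (n : R) * c = 1) ∧ ∀ i j,
    A₁.map (br (A₂ i j)) = Matrix.single j i 1 - (if i = j then c else 0) • 1
  v₁_A₁ : ∀ p i j, br (v₁ p) (A₁ i j) = 0
  v₂_A₁ : ∀ p i j, br (v₂ p) (A₁ i j) = 0
  φ₁_A₁ : ∀ p i j, br (φ₁ p) (A₁ i j) = 0
  φ₂_A₁ : ∀ p i j, br (φ₂ p) (A₁ i j) = 0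
  v₁_v₁ : ∀ p q, br (v₁ p) (v₁ q) = 0
  v₁_v₂ : ∀ p q, br (v₁ p) (v₂ q) = 0
  v₂_v₂ : ∀ p q, br (v₂ p) (v₂ q) = 0
  φ₂_φ₁ : ∀ p q, br (φ₂ p) (φ₁ q) = 0
  φ₁_v₁ : ∀ p q, br (φ₁ p) (v₁ q) = 0
  φ₂_v₂ : ∀ p q, br (φ₂ p) (v₂ q) = 0
  φ₁_v₂ : ∀ p q, br (φ₁ p) (v₂ q) = if p = q then -1 else 0
  φ₂_v₁ : ∀ p q, br (φ₂ p) (v₁ q) = if p = q then 1 else 0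

/-- The flow of `φ₁ v₁` and the moment map equation make the mixed invariants vanish. -/
theorem CanonicalCoordinates.mixed_dotProduct_eq_zero [CharZero K]
    {A₁ A₂ : Matrix (Fin n) (Fin n) R} {v₁ v₂ φ₁ φ₂ : Fin n → R}
    (hcan : CanonicalCoordinates br A₁ A₂ v₁ v₂ φ₁ φ₂)
    (hbr : ∀ f g, algebraMap R K f = 0 → algebraMap R K g = 0 → algebraMap R K (br f g) = 0)
    {A B : Matrix (Fin n) (Fin n) K} {x₁ x₂ ψ₁ ψ₂ : Fin n → K}
    (hA₁ : A₁.map (algebraMap R K) = A)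
    (hv₁ : algebraMap R K ∘ v₁ = x₁) (hv₂ : algebraMap R K ∘ v₂ = x₂)
    (hφ₁ : algebraMap R K ∘ φ₁ = ψ₁) (hφ₂ : algebraMap R K ∘ φ₂ = ψ₂) {k : ℕ}
    (h₁₁ : ψ₁ ⬝ᵥ x₁ = 0) (h₂₂ : ψ₂ ⬝ᵥ (A ^ k *ᵥ x₂) = 0)
    (hM : ⁅A, B⁆ + Matrix.vecMulVec x₁ ψ₂ - Matrix.vecMulVec x₂ ψ₁ = 0) :
    ψ₁ ⬝ᵥ (A ^ k *ᵥ x₂) = 0 ∧ ψ₂ ⬝ᵥ (A ^ k *ᵥ x₁) = 0 := by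
  have hf : algebraMap R K (φ₁ ⬝ᵥ v₁) = 0 := by rw [RingHom.map_dotProduct, hφ₁, hv₁, h₁₁]
  have hg : algebraMap R K (φ₂ ⬝ᵥ (A₁ ^ k *ᵥ v₂)) = 0 := by
    rw [algebraMap_dotProduct_mulVec, Matrix.map_pow, hA₁, hφ₂, hv₂, h₂₂]
  set δ := hamiltonianAt K br (φ₁ ⬝ᵥ v₁) with hδ
  have hδx : ∀ x, δ x = -((hamiltonianAt K br x ∘ φ₁) ⬝ᵥ x₁ +
      ψ₁ ⬝ᵥ (hamiltonianAt K br x ∘ v₁)) := fun x => by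
    rw [hδ, hamiltonianAt_anti hcan.anti, Derivation.map_dotProduct, hφ₁, hv₁]
  have hδA : A₁.map δ = 0 := Matrix.ext fun i j => by
    rw [Matrix.map_apply, hδx]
    simp [dotProduct, hamiltonianAt_apply, hcan.anti (A₁ i j), hcan.φ₁_A₁, hcan.v₁_A₁]
  have hδv : δ ∘ v₂ = -x₁ := funext fun p => by
    rw [Function.comp_apply, hδx]
    simp [dotProduct, hamiltonianAt_apply, hcan.anti (v₂ p), hcan.φ₁_v₂, hcan.v₁_v₂,
      apply_ite (algebraMap R K)]
  have hδφ : δ ∘ φ₂ = -ψ₁ := funext fun p => by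
    rw [Function.comp_apply, hδx]
    simp [dotProduct, hamiltonianAt_apply, hcan.φ₂_φ₁, hcan.φ₂_v₁, apply_ite (algebraMap R K)]
  -- This bracket is minus the sum of the two mixed invariants.
  have hsum : δ (φ₂ ⬝ᵥ (A₁ ^ k *ᵥ v₂)) = 0 := hbr _ _ hf hg
  rw [δ.map_dotProduct, δ.map_mulVec, δ.matrix_map_pow_eq_zero hδA, hδv, hδφ, Matrix.zero_mulVec,
    zero_add, hφ₂, Matrix.map_pow, hA₁, Matrix.mulVec_neg, neg_dotProduct, dotProduct_neg,
    show algebraMap R K ∘ (A₁ ^ k *ᵥ v₂) = A ^ k *ᵥ x₂ from funext fun p => by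
      rw [Function.comp_apply, RingHom.map_mulVec, Matrix.map_pow, hA₁, hv₂]] at hsum
  -- Since `tr (A ^ k [A, B]) = 0`, the moment map equation makes the difference of the mixed
  -- invariants vanish.
  have htr := congrArg (fun N => (A ^ k * N).trace) hM
  simp only [mul_sub, mul_add, Ring.lie_def, Matrix.trace_sub, Matrix.trace_add,
    Matrix.mul_vecMulVec, Matrix.trace_vecMulVec, mul_zero, Matrix.trace_zero] at htr
  rw [← mul_assoc, ← mul_assoc, Matrix.trace_mul_comm (A ^ k * B), ← mul_assoc, ← pow_succ,
    ← pow_succ', sub_self, zero_add, dotProduct_comm, dotProduct_comm _ ψ₁] at htr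
  constructor
  · linear_combination (-1 / 2 : K) * hsum - (1 / 2 : K) * htr
  · linear_combination (-1 / 2 : K) * hsum + (1 / 2 : K) * htr

theorem CanonicalCoordinates.v_eq_zero_or_φ_eq_zero [CharZero K]
    {A₁ A₂ : Matrix (Fin n) (Fin n) R} {v₁ v₂ φ₁ φ₂ : Fin n → R}
    (hcan : CanonicalCoordinates br A₁ A₂ v₁ v₂ φ₁ φ₂)
    (hbr : ∀ f g, algebraMap R K f = 0 → algebraMap R K g = 0 → algebraMap R K (br f g) = 0)
    (hlift : ∀ u : Fin n → K, ∃ c : K, c ≠ 0 ∧ ∃ u' : Fin n → R, algebraMap R K ∘ u' = c • u)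
    {A B : Matrix (Fin n) (Fin n) K} {x₁ x₂ ψ₁ ψ₂ : Fin n → K}
    (hA₁ : A₁.map (algebraMap R K) = A) (hA₂ : A₂.map (algebraMap R K) = B)
    (hv₁ : algebraMap R K ∘ v₁ = x₁) (hv₂ : algebraMap R K ∘ v₂ = x₂)
    (hφ₁ : algebraMap R K ∘ φ₁ = ψ₁) (hφ₂ : algebraMap R K ∘ φ₂ = ψ₂)
    (hA : A ^ n = 0) (hB : B ^ n = 0)
    (h₁₁ : ∀ i ≤ n, ψ₁ ⬝ᵥ (A ^ i *ᵥ x₁) = 0) (h₂₂ : ∀ i ≤ n, ψ₂ ⬝ᵥ (A ^ i *ᵥ x₂) = 0)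
    (hM : ⁅A, B⁆ + Matrix.vecMulVec x₁ ψ₂ - Matrix.vecMulVec x₂ ψ₁ = 0) :
    (ψ₁ = 0 ∧ ψ₂ = 0) ∨ (x₁ = 0 ∧ x₂ = 0) := by
  rcases Nat.eq_zero_or_pos n with rfl | hn
  · exact Or.inl ⟨Subsingleton.elim _ _, Subsingleton.elim _ _⟩
  have hmixed := fun i (hi : i ≤ n) => hcan.mixed_dotProduct_eq_zero hbr hA₁ hv₁ hv₂ hφ₁ hφ₂
    (by simpa using h₁₁ 0 n.zero_le) (h₂₂ i hi) hM
  have h₁₂ : ∀ i ≤ n, ψ₁ ⬝ᵥ (A ^ i *ᵥ x₂) = 0 := fun i hi => (hmixed i hi).1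
  have h₂₁ : ∀ i ≤ n, ψ₂ ⬝ᵥ (A ^ i *ᵥ x₁) = 0 := fun i hi => (hmixed i hi).2
  obtain ⟨c, hc, h₂₁A⟩ := hcan.A₂_A₁
  have hreg : A ^ (n - 1) ≠ 0 := by
    rw [← hA₁]
    exact pow_pred_ne_zero_of_isNilpotent hn hcan.anti hbr hlift (hc hn)
      (fun i j => Matrix.ext (hcan.A₁_A₁ i j)) h₂₁A hcan.trace_A₂ (by rw [hA₁, hA])
      ⟨n, by rw [hA₂, hB]⟩
  have hex : ∃ i, A ^ i *ᵥ x₁ = 0 ∧ A ^ i *ᵥ x₂ = 0 := ⟨n, by simp [hA]⟩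
  classical
  obtain ⟨i, ⟨hi₁, hi₂⟩, hmin⟩ : ∃ i, (A ^ i *ᵥ x₁ = 0 ∧ A ^ i *ᵥ x₂ = 0) ∧
      ∀ j < i, ¬ (A ^ j *ᵥ x₁ = 0 ∧ A ^ j *ᵥ x₂ = 0) :=
    ⟨Nat.find hex, Nat.find_spec hex, fun j hj => Nat.find_min hex hj⟩
  have hin : i ≤ n := by
    by_contra h
    exact hmin n (not_le.1 h) (by simp [hA])
  rcases i with _ | j
  · right
    simpa using And.intro hi₁ hi₂
  left
  obtain ⟨e, he⟩ := Module.End.exists_ker_le_span_singleton (K := K) (V := Fin n → K) (n := n)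
    (by simp) hn (Matrix.toLin' A) (by rw [← Matrix.toLin'_pow, hA, map_zero])
    (by rwa [← Matrix.toLin'_pow, Ne, LinearEquiv.map_eq_zero_iff])
  have hpow : ∀ {ψ x : Fin n → K}, (∀ i ≤ n, ψ ⬝ᵥ (A ^ i *ᵥ x) = 0) →
      ∀ i, ψ ⬝ᵥ (A ^ i *ᵥ x) = 0 := fun {ψ x} h i => by
    rcases le_or_gt i n with hi | hi
    · exact h i hi
    · rw [pow_eq_zero_of_le hi.le hA, Matrix.zero_mulVec, dotProduct_zero]
  -- By minimality `x₁` or `x₂` lies outside `ker (A ^ j)`, hence generates `ker (A ^ (j + 1))` over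
  -- `K[A]`.
  have hkill : ∀ ψ : Fin n → K, (∀ i ≤ n, ψ ⬝ᵥ (A ^ i *ᵥ x₁) = 0) →
      (∀ i ≤ n, ψ ⬝ᵥ (A ^ i *ᵥ x₂) = 0) → ∀ y, A ^ (j + 1) *ᵥ y = 0 → ψ ⬝ᵥ y = 0 := by
    intro ψ hψ₁ hψ₂ y hy
    obtain ⟨x, hx, hx0, hψ⟩ : ∃ x, A ^ (j + 1) *ᵥ x = 0 ∧ A ^ j *ᵥ x ≠ 0 ∧
        ∀ i, ψ ⬝ᵥ (A ^ i *ᵥ x) = 0 := by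
      by_cases h : A ^ j *ᵥ x₁ = 0
      · exact ⟨x₂, hi₂, fun h' => hmin j j.lt_succ_self ⟨h, h'⟩, hpow hψ₂⟩
      · exact ⟨x₁, hi₁, h, hpow hψ₁⟩
    refine Module.End.dual_apply_eq_zero_of_pow_apply_eq_zero (Matrix.toLin' A) he
      (dotProductBilin K K ψ) j x y ?_ ?_ ?_ fun k => ?_
    all_goals rw [← Matrix.toLin'_pow, Matrix.toLin'_apply]
    exacts [hx, hx0, hy, hψ k]
  have hk₁ := hkill ψ₁ h₁₁ h₁₂
  have hk₂ := hkill ψ₂ h₂₁ h₂₂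
  rcases hin.eq_or_lt with hjn | hjn
  · have h0 : ∀ ψ : Fin n → K, (∀ y, A ^ (j + 1) *ᵥ y = 0 → ψ ⬝ᵥ y = 0) → ψ = 0 := fun ψ h =>
      funext fun p => by simpa using h (Pi.single p 1) (by rw [hjn, hA, Matrix.zero_mulVec])
    exact ⟨h0 _ hk₁, h0 _ hk₂⟩
  exfalso
  have hrel := pow_mul_vecMulVec_mul_pow_eq hA hreg ⟨n, hB⟩ hM hjn hi₁ hi₂ hk₁ hk₂
  -- The row of `A ^ (j + 1)` produced by the bracket is multiplied by `A ^ (n - (j + 2))`, so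
  -- exactly the regularity `A ^ (n - 1) ≠ 0` is needed.
  have hjr : j + 1 + (n - (j + 2)) = n - 1 := by omega
  have hmap : ∀ (m : ℕ) (x : Fin n → R) (p : Fin n), algebraMap R K ((A₁ ^ m *ᵥ x) p) =
      (A ^ m *ᵥ (algebraMap R K ∘ x)) p := fun m x p => by
    rw [RingHom.map_mulVec, Matrix.map_pow, hA₁]
  have hmap' : ∀ (m : ℕ) (x : Fin n → R) (p : Fin n), algebraMap R K ((x ᵥ* A₁ ^ m) p) =
      ((algebraMap R K ∘ x) ᵥ* A ^ m) p := fun m x p => by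
    rw [RingHom.map_vecMul, Matrix.map_pow, hA₁]
  have hA₁x : ∀ {x : R}, (∀ i j, br x (A₁ i j) = 0) → ∀ i j, br (A₁ i j) x = 0 :=
    fun h i j => by rw [hcan.anti, h, neg_zero]
  refine hmin j j.lt_succ_self ⟨?_, ?_⟩
  -- The entries of `A₁ ^ (j + 1) v₁` move `φ₂`. In the other case those of `A₁ ^ (j + 1) v₂` move
  -- `φ₁`, with the opposite sign `s = -1`.
  · rw [← hA₁, ← hv₁]
    refine pow_mulVec_eq_zero_of_bilinear_relation (v := v₁) (v' := v₂) (φ := φ₂) (φ' := φ₁)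
      (s := 1) (k := j + 1) (r := n - (j + 2)) hcan.anti hbr (by simp) hcan.A₁_A₁
      (fun i j p => hA₁x (hcan.v₁_A₁ p) i j) hcan.v₁_A₁ hcan.v₁_v₁ hcan.v₂_A₁
      (fun p q => by rw [hcan.anti, hcan.v₁_v₂, neg_zero]) hcan.φ₂_A₁ hcan.φ₂_v₁ hcan.φ₁_A₁
      hcan.φ₁_v₁ (by rw [hA₁, hv₁, hi₁]) (fun p q => ?_) (by rwa [hA₁, hjr])
    rw [map_sub, map_mul, map_mul, hmap, hmap, hmap', hmap', hv₁, hv₂, hφ₁, hφ₂, hrel]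
  · rw [← hA₁, ← hv₂]
    refine pow_mulVec_eq_zero_of_bilinear_relation (v := v₂) (v' := v₁) (φ := φ₁) (φ' := φ₂)
      (s := -1) (k := j + 1) (r := n - (j + 2)) hcan.anti hbr (by simp) hcan.A₁_A₁
      (fun i j p => hA₁x (hcan.v₂_A₁ p) i j) hcan.v₂_A₁ hcan.v₂_v₂ hcan.v₁_A₁
      hcan.v₁_v₂ hcan.φ₁_A₁ hcan.φ₁_v₂ hcan.φ₂_A₁
      hcan.φ₂_v₂ (by rw [hA₁, hv₂, hi₂]) (fun p q => ?_) (by rwa [hA₁, hjr])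
    rw [map_sub, map_mul, map_mul, hmap, hmap, hmap', hmap', hv₁, hv₂, hφ₁, hφ₂, ← neg_eq_zero,
      neg_sub, hrel]

end Core

/-- The derivations of a commutative ring. -/
abbrev SelfDerivation (R : Type*) [CommRing R] : Type _ := Derivation ℤ R R

/-- An additive map which satisfies the Leibniz rule, as a derivation. -/
def SelfDerivation.ofLeibniz {R : Type*} [CommRing R] (d : R → R)
    (add : ∀ f g, d (f + g) = d f + d g) (leibniz : ∀ f g, d (f * g) = f * d g + g * d f) :
    SelfDerivation R :=
  Derivation.mk' (AddMonoidHom.mk' d add).toIntLinearMap leibniz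

namespace GeoStat

/-! ### Canonical coordinates on the cotangent space of `X` -/

section LinearCombinations

variable {n : ℕ} {ι : Type*}

theorem XSpace.A_sum_smul {R : Type*} [CommRing R] (s : Finset ι) (a : ι → R) (x : ι → XSpace n R)
    (i j : Fin n) : (∑ k ∈ s, a k • x k).A i j = ∑ k ∈ s, a k * (x k).A i j := by
  classical
  induction s using Finset.induction_on with
  | empty => rfl
  | insert k s hk ih =>
    rw [Finset.sum_insert hk, Finset.sum_insert hk, ← ih]
    rfl

theorem XSpace.v_sum_smul {R : Type*} [CommRing R] (s : Finset ι) (a : ι → R) (x : ι → XSpace n R)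
    (i : Fin n) : (∑ k ∈ s, a k • x k).v i = ∑ k ∈ s, a k * (x k).v i := by
  classical
  induction s using Finset.induction_on with
  | empty => rfl
  | insert k s hk ih =>
    rw [Finset.sum_insert hk, Finset.sum_insert hk, ← ih]
    rfl

theorem XSpace.φ_sum_smul {R : Type*} [CommRing R] (s : Finset ι) (a : ι → R) (x : ι → XSpace n R)
    (i : Fin n) : (∑ k ∈ s, a k • x k).φ i = ∑ k ∈ s, a k * (x k).φ i := by
  classical
  induction s using Finset.induction_on with
  | empty => rfl
  | insert k s hk ih =>
    rw [Finset.sum_insert hk, Finset.sum_insert hk, ← ih]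
    rfl

end LinearCombinations

section PoissonBracket

variable {F ι : Type*} [Field F] [Fintype ι]

theorem poissonBracket_add_right (f g h : CoordRing F ι) :
    poissonBracket f (g + h) = poissonBracket f g + poissonBracket f h := by
  simp only [poissonBracket, map_add, ← Finset.sum_add_distrib]
  exact Finset.sum_congr rfl fun k _ => by ring

theorem poissonBracket_mul_right (f g h : CoordRing F ι) :
    poissonBracket f (g * h) = g * poissonBracket f h + h * poissonBracket f g := by
  simp only [poissonBracket, Derivation.leibniz, Finset.mul_sum, smul_eq_mul,
    ← Finset.sum_add_distrib]
  exact Finset.sum_congr rfl fun k _ => by ring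

theorem poissonBracket_anti (f g : CoordRing F ι) : poissonBracket f g = -poissonBracket g f := by
  rw [poissonBracket, poissonBracket, ← Finset.sum_neg_distrib]
  exact Finset.sum_congr rfl fun k _ => by ring

/-- The derivation `{f, ·}`. -/
noncomputable def hamiltonian (f : CoordRing F ι) : SelfDerivation (CoordRing F ι) :=
  SelfDerivation.ofLeibniz (poissonBracket f) (poissonBracket_add_right f)
    (poissonBracket_mul_right f)

theorem hamiltonian_apply (f g : CoordRing F ι) : hamiltonian f g = poissonBracket f g := rfl

theorem hamiltonian_anti (f g : CoordRing F ι) : hamiltonian f g = -hamiltonian g f :=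
  poissonBracket_anti f g

/-- The linear form with coefficients `a` in the coordinates. -/
noncomputable def qForm (a : ι → F) : CoordRing F ι :=
  ∑ k, MvPolynomial.X (Sum.inl k) * MvPolynomial.C (a k)

/-- The linear form with coefficients `a` in the momenta. -/
noncomputable def pForm (a : ι → F) : CoordRing F ι :=
  ∑ k, MvPolynomial.X (Sum.inr k) * MvPolynomial.C (a k)

theorem pderiv_inl_qForm (a : ι → F) (k : ι) :
    MvPolynomial.pderiv (Sum.inl k) (qForm a) = MvPolynomial.C (a k) := by
  classical
  simp [qForm, MvPolynomial.pderiv_X, Pi.single_apply]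

theorem pderiv_inr_qForm (a : ι → F) (k : ι) :
    MvPolynomial.pderiv (Sum.inr k) (qForm a) = 0 := by
  classical
  simp [qForm, MvPolynomial.pderiv_X]

theorem pderiv_inr_pForm (a : ι → F) (k : ι) :
    MvPolynomial.pderiv (Sum.inr k) (pForm a) = MvPolynomial.C (a k) := by
  classical
  simp [pForm, MvPolynomial.pderiv_X, Pi.single_apply]

theorem pderiv_inl_pForm (a : ι → F) (k : ι) :
    MvPolynomial.pderiv (Sum.inl k) (pForm a) = 0 := by
  classical
  simp [pForm, MvPolynomial.pderiv_X]

theorem hamiltonian_qForm_qForm (a a' : ι → F) : hamiltonian (qForm a) (qForm a') = 0 := by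
  simp [hamiltonian_apply, poissonBracket, pderiv_inr_qForm]

theorem hamiltonian_pForm_pForm (a a' : ι → F) : hamiltonian (pForm a) (pForm a') = 0 := by
  simp [hamiltonian_apply, poissonBracket, pderiv_inl_pForm]

theorem hamiltonian_pForm_qForm (a a' : ι → F) :
    hamiltonian (pForm a) (qForm a') = MvPolynomial.C (∑ k, a k * a' k) := by
  simp [hamiltonian_apply, poissonBracket, pderiv_inl_pForm, pderiv_inr_qForm, pderiv_inl_qForm,
    pderiv_inr_pForm]

variable {n : ℕ} (b : Module.Basis ι F (XSpace n F))

/-- The function `⟨c, x₁⟩` of `(x₁, x₂) ∈ X × X`. -/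
noncomputable def qCoord (c : XSpace n F) : CoordRing F ι :=
  qForm fun k => scalarProduct n F c (b k)

theorem hamiltonian_qCoord_qCoord (c d : XSpace n F) :
    hamiltonian (qCoord b c) (qCoord b d) = 0 := hamiltonian_qForm_qForm _ _

end PoissonBracket

section Entries

variable {n : ℕ} {F : Type*} [Field F]

theorem scalarProduct_comm (x y : XSpace n F) :
    scalarProduct n F x y = scalarProduct n F y x := by
  rw [scalarProduct_apply, scalarProduct_apply, Matrix.trace_mul_comm]
  ring

/-- The dual of the matrix entry `(i, j)`, as an element of `X`. -/
noncomputable def entryA (F : Type*) [Field F] [CharZero F] (i j : Fin n) : XSpace n F :=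
  (⟨Matrix.single j i 1 - (if i = j then (n : F)⁻¹ else 0) • 1, (mem_sl_iff _).2 (by
    rcases Nat.eq_zero_or_pos n with rfl | hn
    · exact i.elim0
    have hn' : (n : F) ≠ 0 := Nat.cast_ne_zero.2 hn.ne'
    rw [Matrix.trace_sub, Matrix.trace_smul, Matrix.trace_one, Fintype.card_fin]
    by_cases h : i = j
    · simp [h, hn', Matrix.trace_single_eq_same]
    · simp [h, Matrix.trace_single_eq_of_ne _ _ _ (Ne.symm h)])⟩, 0, 0)

/-- The dual of the `i`-th coordinate of `V`, as an element of `X`. -/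
def entryV (F : Type*) [Field F] (i : Fin n) : XSpace n F := (0, 0, Pi.single i 1)

/-- The dual of the `i`-th coordinate of `V*`, as an element of `X`. -/
def entryφ (F : Type*) [Field F] (i : Fin n) : XSpace n F := (0, Pi.single i 1, 0)

theorem scalarProduct_entryA [CharZero F] (i j : Fin n) (x : XSpace n F) :
    scalarProduct n F (entryA F i j) x = x.A i j := by
  have h : (entryA F i j).A = Matrix.single j i 1 - (if i = j then (n : F)⁻¹ else 0) • 1 := rfl
  have h₁ : (entryA F i j).v = 0 := rfl
  have h₂ : (entryA F i j).φ = 0 := rfl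
  rw [scalarProduct_apply, h, h₁, h₂, sub_mul, Matrix.trace_sub, Matrix.trace_single_mul,
    Matrix.smul_mul, one_mul, Matrix.trace_smul, x.trace_A]
  simp

theorem scalarProduct_entryV (i : Fin n) (x : XSpace n F) :
    scalarProduct n F (entryV F i) x = x.v i := by
  rw [scalarProduct_apply]
  simp [entryV, XSpace.A, XSpace.v, XSpace.φ]

theorem scalarProduct_entryφ (i : Fin n) (x : XSpace n F) :
    scalarProduct n F (entryφ F i) x = x.φ i := by
  rw [scalarProduct_apply]
  simp [entryφ, XSpace.A, XSpace.v, XSpace.φ]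

end Entries

section Coordinates

variable {n : ℕ} {F ι : Type*} [Field F] [CharZero F] [Fintype ι] [DecidableEq ι]
  (b : Module.Basis ι F (XSpace n F))

/-- Expanding `d` in the dual basis gives this completeness relation. It makes the bracket of `⟨c,
x₂⟩` and `⟨d, x₁⟩` independent of `b`. -/
theorem sum_scalarProduct_mul (c d : XSpace n F) :
    ∑ k, scalarProduct n F c
        ((scalarProduct n F).dualBasis (scalarProduct_nondegenerate n F) b k) *
      scalarProduct n F d (b k) = scalarProduct n F c d := by
  conv_rhs =>
    rw [← ((scalarProduct n F).dualBasis (scalarProduct_nondegenerate n F) b).sum_repr d, map_sum]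
  refine Finset.sum_congr rfl fun k _ => ?_
  rw [LinearMap.BilinForm.dualBasis_repr_apply, map_smul, smul_eq_mul, mul_comm]

/-- The function `⟨c, x₂⟩` of `(x₁, x₂) ∈ X × X`. -/
noncomputable def pCoord (c : XSpace n F) : CoordRing F ι :=
  pForm fun k => scalarProduct n F c
    ((scalarProduct n F).dualBasis (scalarProduct_nondegenerate n F) b k)

theorem hamiltonian_pCoord_pCoord (c d : XSpace n F) :
    hamiltonian (pCoord b c) (pCoord b d) = 0 := hamiltonian_pForm_pForm _ _

theorem hamiltonian_pCoord_qCoord (c d : XSpace n F) :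
    hamiltonian (pCoord b c) (qCoord b d) = MvPolynomial.C (scalarProduct n F c d) := by
  rw [pCoord, qCoord, hamiltonian_pForm_qForm, sum_scalarProduct_mul]

theorem hamiltonian_qCoord_pCoord (c d : XSpace n F) :
    hamiltonian (qCoord b c) (pCoord b d) = -MvPolynomial.C (scalarProduct n F d c) := by
  rw [hamiltonian_anti, hamiltonian_pCoord_qCoord]

theorem tautologicalPoint_fst_A (i j : Fin n) :
    (tautologicalPoint b).1.A i j = qCoord b (entryA F i j) := by
  rw [tautologicalPoint, XSpace.A_sum_smul, qCoord, qForm]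
  simp only [scalarProduct_entryA]
  rfl

theorem tautologicalPoint_snd_A (i j : Fin n) :
    (tautologicalPoint b).2.A i j = pCoord b (entryA F i j) := by
  rw [tautologicalPoint, XSpace.A_sum_smul, pCoord, pForm]
  simp only [scalarProduct_entryA]
  rfl

theorem tautologicalPoint_fst_v (i : Fin n) :
    (tautologicalPoint b).1.v i = qCoord b (entryV F i) := by
  rw [tautologicalPoint, XSpace.v_sum_smul, qCoord, qForm]
  simp only [scalarProduct_entryV]
  rfl

theorem tautologicalPoint_snd_v (i : Fin n) :
    (tautologicalPoint b).2.v i = pCoord b (entryV F i) := by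
  rw [tautologicalPoint, XSpace.v_sum_smul, pCoord, pForm]
  simp only [scalarProduct_entryV]
  rfl

theorem tautologicalPoint_fst_φ (i : Fin n) :
    (tautologicalPoint b).1.φ i = qCoord b (entryφ F i) := by
  rw [tautologicalPoint, XSpace.φ_sum_smul, qCoord, qForm]
  simp only [scalarProduct_entryφ]
  rfl

theorem tautologicalPoint_snd_φ (i : Fin n) :
    (tautologicalPoint b).2.φ i = pCoord b (entryφ F i) := by
  rw [tautologicalPoint, XSpace.φ_sum_smul, pCoord, pForm]
  simp only [scalarProduct_entryφ]
  rfl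

/-- Every coordinate is a scalar product with a fixed vector of `X`, so each bracket is zero or, up
to sign, a scalar product of two such vectors. -/
theorem canonicalCoordinates_tautologicalPoint :
    CanonicalCoordinates hamiltonian (tautologicalPoint b).1.A (tautologicalPoint b).2.A
      (tautologicalPoint b).1.v (tautologicalPoint b).2.v
      (tautologicalPoint b).1.φ (tautologicalPoint b).2.φ where
  anti := hamiltonian_anti
  trace_A₂ := XSpace.trace_A _
  A₁_A₁ i j p q := by
    rw [tautologicalPoint_fst_A, tautologicalPoint_fst_A, hamiltonian_qCoord_qCoord]
  A₂_A₁ := by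
    refine ⟨MvPolynomial.C (n : F)⁻¹, fun hn => ?_, fun i j => ?_⟩
    · have hn' : (n : F) ≠ 0 := Nat.cast_ne_zero.2 hn.ne'
      rw [← map_natCast MvPolynomial.C, ← map_mul, mul_inv_cancel₀ hn', map_one]
    · ext p q : 1
      rw [Matrix.map_apply, tautologicalPoint_fst_A, tautologicalPoint_snd_A,
        hamiltonian_pCoord_qCoord, scalarProduct_comm, scalarProduct_entryA]
      simp only [entryA, XSpace.A, Matrix.sub_apply, Matrix.smul_apply, Matrix.single_apply,
        Matrix.one_apply, smul_eq_mul, map_sub, map_mul, apply_ite MvPolynomial.C, map_one,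
        map_zero]
  v₁_A₁ p i j := by
    rw [tautologicalPoint_fst_A, tautologicalPoint_fst_v, hamiltonian_qCoord_qCoord]
  v₂_A₁ p i j := by
    rw [tautologicalPoint_fst_A, tautologicalPoint_snd_v, hamiltonian_pCoord_qCoord,
      scalarProduct_entryV]
    simp [entryA, XSpace.v]
  φ₁_A₁ p i j := by
    rw [tautologicalPoint_fst_A, tautologicalPoint_fst_φ, hamiltonian_qCoord_qCoord]
  φ₂_A₁ p i j := by
    rw [tautologicalPoint_fst_A, tautologicalPoint_snd_φ, hamiltonian_pCoord_qCoord,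
      scalarProduct_entryφ]
    simp [entryA, XSpace.φ]
  v₁_v₁ p q := by
    rw [tautologicalPoint_fst_v, tautologicalPoint_fst_v, hamiltonian_qCoord_qCoord]
  v₁_v₂ p q := by
    rw [tautologicalPoint_fst_v, tautologicalPoint_snd_v, hamiltonian_qCoord_pCoord,
      scalarProduct_entryV]
    simp [entryV, XSpace.v]
  v₂_v₂ p q := by
    rw [tautologicalPoint_snd_v, tautologicalPoint_snd_v, hamiltonian_pCoord_pCoord]
  φ₂_φ₁ p q := by
    rw [tautologicalPoint_fst_φ, tautologicalPoint_snd_φ, hamiltonian_pCoord_qCoord,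
      scalarProduct_entryφ]
    simp [entryφ, XSpace.φ]
  φ₁_v₁ p q := by
    rw [tautologicalPoint_fst_v, tautologicalPoint_fst_φ, hamiltonian_qCoord_qCoord]
  φ₂_v₂ p q := by
    rw [tautologicalPoint_snd_v, tautologicalPoint_snd_φ, hamiltonian_pCoord_pCoord]
  φ₁_v₂ p q := by
    rw [tautologicalPoint_fst_φ, tautologicalPoint_snd_v, hamiltonian_qCoord_pCoord,
      scalarProduct_entryV]
    simp only [entryφ, XSpace.v, Pi.single_apply, apply_ite MvPolynomial.C, map_one, map_zero]
    rcases eq_or_ne p q with rfl | h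
    · simp
    · simp [h, h.symm]
  φ₂_v₁ p q := by
    rw [tautologicalPoint_fst_v, tautologicalPoint_snd_φ, hamiltonian_pCoord_qCoord,
      scalarProduct_entryφ]
    simp [entryV, XSpace.φ, Pi.single_apply, apply_ite MvPolynomial.C]

end Coordinates

/-! ### Reduction to the minimal primes of the vanishing ideal -/

section Reduction

theorem SCheck.equations {n : ℕ} {K : Type*} [Field K] {x : XSpace n K × XSpace n K}
    (hx : x ∈ SCheck n K) :
    x.1.A ^ n = 0 ∧ x.2.A ^ n = 0 ∧
      (∀ i ≤ n, x.1.φ ⬝ᵥ (x.1.A ^ i *ᵥ x.1.v) = 0) ∧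
      (∀ i ≤ n, x.2.φ ⬝ᵥ (x.1.A ^ i *ᵥ x.2.v) = 0) ∧
      ⁅x.1.A, x.2.A⁆ + Matrix.vecMulVec x.1.v x.2.φ - Matrix.vecMulVec x.2.v x.1.φ = 0 :=
  ⟨hx.1.1.1, hx.1.2.2.1.1, hx.1.1.2, hx.1.2.1.2, hx.2⟩

theorem CanonicalCoordinates.mem_CCheck {n : ℕ} {R K : Type*} [CommRing R] [Field K] [CharZero K]
    [Algebra R K] {br : R → Derivation ℤ R R} {y : XSpace n R × XSpace n R}
    (hcan : CanonicalCoordinates br y.1.A y.2.A y.1.v y.2.v y.1.φ y.2.φ)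
    (hbr : ∀ f g, algebraMap R K f = 0 → algebraMap R K g = 0 → algebraMap R K (br f g) = 0)
    (hlift : ∀ u : Fin n → K, ∃ c : K, c ≠ 0 ∧ ∃ u' : Fin n → R, algebraMap R K ∘ u' = c • u)
    (hS : (y.1.map (algebraMap R K), y.2.map (algebraMap R K)) ∈ SCheck n K) :
    (y.1.map (algebraMap R K), y.2.map (algebraMap R K)) ∈ CCheck n K := by
  obtain ⟨hA, hB, h₁, h₂, hM⟩ := SCheck.equations hS
  exact hcan.v_eq_zero_or_φ_eq_zero hbr hlift rfl rfl rfl rfl rfl rfl hA hB h₁ h₂ hM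

variable {F ι : Type*} [Field F] [Fintype ι]

/-- There are finitely many minimal primes, so some `s` outside `p` lies in all the others. Then `s
* f` lies in every minimal prime, hence in the radical ideal `I`. -/
theorem exists_mul_mem_of_mem_minimalPrimes {R : Type*} [CommRing R] [IsNoetherianRing R]
    {I p : Ideal R} (hI : I.IsRadical) (hp : p ∈ I.minimalPrimes) {f : R} (hf : f ∈ p) :
    ∃ s ∉ p, s * f ∈ I := by
  have : p.IsPrime := hp.1.1
  have hfin : (I.minimalPrimes \ {p}).Finite :=
    (Ideal.finite_minimalPrimes_of_isNoetherianRing R I).subset Set.sdiff_subset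
  obtain ⟨s, hs, hsp⟩ : ∃ s ∈ hfin.toFinset.inf id, s ∉ p := by
    by_contra! h
    obtain ⟨q, hq, hqp⟩ := (Ideal.IsPrime.inf_le' ‹_›).1 h
    have hq' := (Set.Finite.mem_toFinset _).1 hq
    exact hq'.2 (le_antisymm hqp (hp.2 hq'.1.1 hqp))
  refine ⟨s, hsp, ?_⟩
  rw [← hI.radical, ← Ideal.sInf_minimalPrimes, Ideal.mem_sInf]
  intro q hq
  by_cases hqp : q = p
  · exact hqp ▸ p.mul_mem_left s hf
  · exact q.mul_mem_right f
      (Finset.inf_le (f := id) ((Set.Finite.mem_toFinset hfin).2 ⟨hq, hqp⟩) hs)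

/-- Multipliers outside `p` move `f` and `g` into `I`. By the Leibniz rule the bracket of the
products is `s * t * poissonBracket f g` up to terms in `p`. -/
theorem poissonBracket_mem_of_mem_minimalPrimes {I p : Ideal (CoordRing F ι)} (hI : I.IsRadical)
    (hp : p ∈ I.minimalPrimes) (h : ∀ f ∈ I, ∀ g ∈ I, poissonBracket f g ∈ I)
    {f g : CoordRing F ι} (hf : f ∈ p) (hg : g ∈ p) : poissonBracket f g ∈ p := by
  have : p.IsPrime := hp.1.1
  obtain ⟨s, hs, hsf⟩ := exists_mul_mem_of_mem_minimalPrimes hI hp hf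
  obtain ⟨t, ht, htg⟩ := exists_mul_mem_of_mem_minimalPrimes hI hp hg
  have hst := hp.1.2 (h _ hsf _ htg)
  have key : poissonBracket (s * f) (t * g) - f * (t * poissonBracket s g) -
      g * poissonBracket (s * f) t = s * t * poissonBracket f g := by
    rw [poissonBracket_mul_right, poissonBracket_anti (s * f) g, poissonBracket_mul_right,
      poissonBracket_anti f g, poissonBracket_anti s g]
    ring
  have hmem : s * t * poissonBracket f g ∈ p := by
    rw [← key]
    exact p.sub_mem (p.sub_mem hst (p.mul_mem_right _ hf)) (p.mul_mem_right _ hg)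
  exact ((‹p.IsPrime›.mem_or_mem hmem).resolve_left
    fun h => (‹p.IsPrime›.mem_or_mem h).elim hs ht)

/-- The residue field is the fraction field of `R ⧸ p`; `c` is a common denominator. -/
theorem exists_lift_residueField {R : Type*} [CommRing R] (p : Ideal R) [p.IsPrime] {n : ℕ}
    (u : Fin n → p.ResidueField) : ∃ c : p.ResidueField, c ≠ 0 ∧ ∃ u' : Fin n → R,
      algebraMap R p.ResidueField ∘ u' = c • u := by
  obtain ⟨c, hc⟩ := IsLocalization.exist_integer_multiples_of_finite (nonZeroDivisors (R ⧸ p)) u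
  choose w hw using hc
  choose u' hu' using fun i => Ideal.Quotient.mk_surjective (w i)
  refine ⟨algebraMap (R ⧸ p) p.ResidueField c, ?_, u', funext fun i => ?_⟩
  · exact IsFractionRing.to_map_ne_zero_of_mem_nonZeroDivisors c.2
  · rw [Function.comp_apply, ← Ideal.algebraMap_quotient_residueField_mk, hu', hw, Pi.smul_apply,
      Algebra.smul_def, smul_eq_mul]

theorem pointAt_mem_CCheck [CharZero F] [DecidableEq ι] {n : ℕ} (b : Module.Basis ι F (XSpace n F))
    (t : PrimeSpectrum (CoordRing F ι))
    (ht : ∀ f ∈ t.asIdeal, ∀ g ∈ t.asIdeal, poissonBracket f g ∈ t.asIdeal)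
    (hS : t ∈ SCheckLocus b) : t ∈ CCheckLocus b := by
  have : CharZero t.asIdeal.ResidueField :=
    charZero_of_injective_algebraMap (algebraMap F t.asIdeal.ResidueField).injective
  have hbr : ∀ f g : CoordRing F ι, algebraMap (CoordRing F ι) t.asIdeal.ResidueField f = 0 →
      algebraMap (CoordRing F ι) t.asIdeal.ResidueField g = 0 →
      algebraMap (CoordRing F ι) t.asIdeal.ResidueField (hamiltonian f g) = 0 := fun f g hf hg =>
    Ideal.algebraMap_residueField_eq_zero.2 (ht f (Ideal.algebraMap_residueField_eq_zero.1 hf)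
      g (Ideal.algebraMap_residueField_eq_zero.1 hg))
  exact CanonicalCoordinates.mem_CCheck (canonicalCoordinates_tautologicalPoint b) hbr
    (exists_lift_residueField t.asIdeal) hS

/-- A coordinate vanishes at a point exactly when it lies in the prime ideal, and the ideal grows
under specialization. -/
theorem CCheckLocus_of_le [CharZero F] [DecidableEq ι] {n : ℕ} (b : Module.Basis ι F (XSpace n F))
    {s t : PrimeSpectrum (CoordRing F ι)} (hst : s ≤ t) (hs : s ∈ CCheckLocus b) :
    t ∈ CCheckLocus b := by
  have key : ∀ w : Fin n → CoordRing F ι, (fun i => algebraMap _ s.asIdeal.ResidueField (w i)) = 0 →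
      (fun i => algebraMap _ t.asIdeal.ResidueField (w i)) = 0 := fun w hw => funext fun i =>
    Ideal.algebraMap_residueField_eq_zero.2
      (hst (Ideal.algebraMap_residueField_eq_zero.1 (congrFun hw i)))
  exact hs.imp (fun h => ⟨key _ h.1, key _ h.2⟩) fun h => ⟨key _ h.1, key _ h.2⟩

end Reduction

end GeoStat

theorem mainTheorem4 {F : Type*} [RCLike F] (n : ℕ)
    {ι : Type*} [Fintype ι] [DecidableEq ι] (b : Module.Basis ι F (GeoStat.XSpace n F))
    (T : Set (PrimeSpectrum (GeoStat.CoordRing F ι))) (hT : IsLocallyClosed T)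
    (hcois : GeoStat.IsCoisotropic T) (hS : T ⊆ GeoStat.SCheckLocus b) :
    T ⊆ GeoStat.CCheckLocus b := by
  obtain ⟨U, Z, hU, hZ, rfl⟩ := hT
  intro t ht
  set I := PrimeSpectrum.vanishingIdeal (closure (U ∩ Z)) with hI
  have hIt : I ≤ t.asIdeal := by
    rw [hI, PrimeSpectrum.vanishingIdeal_closure]
    exact fun f hf => (PrimeSpectrum.mem_vanishingIdeal _ _).1 hf t ht
  obtain ⟨p, hp, hpt⟩ := Ideal.exists_minimalPrimes_le hIt
  let s : PrimeSpectrum (GeoStat.CoordRing F ι) := ⟨p, hp.1.1⟩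
  have hst : s ≤ t := hpt
  -- Local closedness puts the generic point `s` in `T`: open sets are stable under generalization,
  -- and `Z` contains the closure of `T`.
  have hsU : s ∈ U :=
    hU.stableUnderGeneralization ((PrimeSpectrum.le_iff_specializes s t).1 hst) ht.1
  have hsZ : s ∈ closure (U ∩ Z) := by
    rw [← PrimeSpectrum.zeroLocus_vanishingIdeal_eq_closure,
      ← PrimeSpectrum.vanishingIdeal_closure]
    exact hp.1.2
  have hs : s ∈ U ∩ Z := ⟨hsU, closure_minimal Set.inter_subset_right hZ hsZ⟩
  refine GeoStat.CCheckLocus_of_le b hst (GeoStat.pointAt_mem_CCheck b s ?_ (hS hs))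
  exact fun f hf g hg => GeoStat.poissonBracket_mem_of_mem_minimalPrimes
    (PrimeSpectrum.isRadical_vanishingIdeal _) hp hcois hf hg
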